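/- Let $l>0$ and let $\mathcal C$ be the flat two-dimensional cone of length $l$: in polar coordinates its points are $(r,\theta)$, $r\ge 0$, with $\theta$ taken modulo $l$, the points with $r=0$ being identified to one point, the vertex $0$; the metric away from $0$ is $dr^2+r^2d\theta^2$. For $R>0$ let $\mathcal C_R=\{r<R\}$, and for $u\in H^1(\mathcal C_R)$ let $$J(u,\mathcal C_R)=\int_{\mathcal C_R}|Du|^2+\chi_{\{u>0\}}.$$ A minimizer on $\mathcal C_R$ is a $u\in H^1(\mathcal C_R)$ with $J(u,\mathcal C_R)\le J(v,\mathcal C_R)$ for all $v\in H^1(\mathcal C_R)$ with $v-u\in H^1_0(\mathcal C_R)$. (1) Let $l\ge 4\pi$. Let $\phi_+$ be the isometry $(r,\theta)\mapsto r(\cos\theta,\sin\theta)$ of the sector $U^+=\{r>0,\ |\theta|<\pi\}$ onto $\mathbb R^2\setminus\{x_2=0,\ x_1\le 0\}$, and $\phi_-$ the isometry $(r,\theta)\mapsto r(\cos(\theta-\tfrac l2+\pi),\sin(\theta-\tfrac l2+\pi))$ of the sector $U^-=\{r>0,\ |\theta-\tfrac l2|<\pi\}$ onto $\mathbb R^2\setminus\{x_2=0,\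 x_1\ge 0\}$. Let $u:\mathcal C\to[0,\infty)$ be the function with $u=x_1^+\circ\phi_+$ on $U^+$, $u=x_1^-\circ\phi_-$ on $U^-$, and $u=0$ elsewhere. Then for every $R>0$, $u$ is a minimizer on $\mathcal C_R$, and it is the only one with its boundary values: every $v\in H^1(\mathcal C_R)$ with $v-u\in H_0^1(\mathcal C_R)$ and $J(v,\mathcal C_R)\le J(u,\mathcal C_R)$ equals $u$ almost everywhere. The set $\{u>0\}\cap\mathcal C_R$ has exactly two connected components, and the vertex is in the closure of each of them. (2) More generally, let $k\ge 1$ be an integer and $l\ge 4k\pi$. Let $u:\mathcal C\to[0,\infty)$ be the function with $u(r,\theta)=\max\bigl(r\cos(\theta-\tfrac{jl}{k}),0\bigr)$ for $r>0$, $|\theta-\tfrac{jl}{k}|<\pi$, $j=0,\dots,k-1$, and $u=0$ elsewhere. Then for every $R>0$, $u$ is a minimizer on $\mathcal C_R$, the set $\{u>0\}\cap\mathcal C_R$ has exactly $k$ connected components, and the vertex is in the closure of each of them. -/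

import Mathlib

open Set MeasureTheory Filter Topology
open scoped NNReal ENNReal

/-- Identification of polar coordinates `(r, θ)`, `r ≥ 0`: the angle is taken modulo `l`, and all
the points with `r = 0` are one point. -/
def coneSetoid (l : ℝ) : Setoid (ℝ≥0 × ℝ) where
  r p q := p.1 = q.1 ∧ (p.1 = 0 ∨ ∃ n : ℤ, q.2 = p.2 + n * l)
  iseqv :=
    { refl := fun p => ⟨rfl, Or.inr ⟨0, by simp⟩⟩
      symm := by
        rintro p q ⟨h, h0 | ⟨n, hn⟩⟩
        · exact ⟨h.symm, Or.inl (h ▸ h0)⟩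
        · exact ⟨h.symm, Or.inr ⟨-n, by rw [hn]; push_cast; ring⟩⟩
      trans := by
        rintro p q s ⟨h, h0 | ⟨n, hn⟩⟩ ⟨h', h0' | ⟨m, hm⟩⟩
        · exact ⟨h.trans h', Or.inl h0⟩
        · exact ⟨h.trans h', Or.inl h0⟩
        · exact ⟨h.trans h', Or.inl (h.trans h0')⟩
        · exact ⟨h.trans h', Or.inr ⟨n + m, by rw [hm, hn]; push_cast; ring⟩⟩ }

/-- The two dimensional cone of length `l` (its vertex included). The complement of the vertex is
the universal covering of the punctured plane modulo the rotation by the angle `l`. -/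
def Cone (l : ℝ) : Type := Quotient (coneSetoid l)

namespace Cone

instance (l : ℝ) : TopologicalSpace (Cone l) :=
  inferInstanceAs (TopologicalSpace (Quotient (coneSetoid l)))

instance (l : ℝ) : MeasurableSpace (Cone l) := borel (Cone l)

instance (l : ℝ) : BorelSpace (Cone l) := ⟨rfl⟩

/-- The point with polar coordinates `(r, θ)` (meant for `r ≥ 0`). -/
noncomputable def polar (l : ℝ) (p : ℝ × ℝ) : Cone l :=
  Quotient.mk (coneSetoid l) (p.1.toNNReal, p.2)

theorem continuous_polar (l : ℝ) : Continuous (polar l) :=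
  continuous_quotient_mk'.comp ((continuous_real_toNNReal.comp continuous_fst).prodMk
    continuous_snd)

/-- The vertex of the cone. -/
noncomputable def vertex (l : ℝ) : Cone l := polar l (0, 0)

/-- The distance to the vertex. -/
def radius {l : ℝ} : Cone l → ℝ :=
  Quotient.lift (fun p : ℝ≥0 × ℝ => (p.1 : ℝ)) (fun _ _ h => congrArg _ h.1)

/-- The part of the cone in the open ball of radius `R` centred at the vertex. -/
def ball (l R : ℝ) : Set (Cone l) := {x | radius x < R}

/-- The area measure `r dr dθ` of the cone. -/
noncomputable def area (l : ℝ) : Measure (Cone l) :=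
  ((volume.restrict (Ioi (0 : ℝ) ×ˢ Ioc (0 : ℝ) l)).withDensity
    (fun p => ENNReal.ofReal p.1)).map (polar l)

/-- The preimage of `Ω ∖ {0}` in the universal covering, in the coordinates `(r, θ)`. -/
def lift {l : ℝ} (Ω : Set (Cone l)) : Set (ℝ × ℝ) := {p | 0 < p.1 ∧ polar l p ∈ Ω}

/-- `G` is the distributional gradient of `u` in `Ω`, written in the orthonormal frame
`∂_r, r⁻¹ ∂_θ` of the cone minus its vertex: `G 0 = ∂_r u` and `G 1 = r⁻¹ ∂_θ u`. -/
structure HasWeakGradient {l : ℝ} (Ω : Set (Cone l)) (u : Cone l → ℝ)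
    (G : Cone l → EuclideanSpace ℝ (Fin 2)) : Prop where
  locInt : LocallyIntegrableOn (fun p => u (polar l p)) (lift Ω) volume
  locInt_grad : LocallyIntegrableOn (fun p => G (polar l p)) (lift Ω) volume
  radial : ∀ φ : ℝ × ℝ → ℝ, ContDiff ℝ (⊤ : ℕ∞) φ → HasCompactSupport φ → tsupport φ ⊆ lift Ω →
    ∫ p, u (polar l p) * fderiv ℝ φ p (1, 0) = -∫ p, G (polar l p) 0 * φ p
  angular : ∀ φ : ℝ × ℝ → ℝ, ContDiff ℝ (⊤ : ℕ∞) φ → HasCompactSupport φ → tsupport φ ⊆ lift Ω →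
    ∫ p, u (polar l p) * fderiv ℝ φ p (0, 1) = -∫ p, (p.1 * G (polar l p) 1) * φ p

open Classical in
/-- The distributional gradient `Du` in `Ω` (unique almost everywhere in `Ω` when it exists). -/
noncomputable def weakGrad {l : ℝ} (Ω : Set (Cone l)) (u : Cone l → ℝ) :
    Cone l → EuclideanSpace ℝ (Fin 2) :=
  if h : ∃ G, HasWeakGradient Ω u G then h.choose else 0

/-- `u ∈ H¹(Ω)`. -/
def MemH1 {l : ℝ} (Ω : Set (Cone l)) (u : Cone l → ℝ) : Prop :=
  MemLp u 2 ((area l).restrict Ω) ∧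
    ∃ G, HasWeakGradient Ω u G ∧ MemLp G 2 ((area l).restrict Ω)

/-- Test functions of `Ω`: compactly supported in `Ω`, continuous (also at the vertex), smooth away
from the vertex, with bounded gradient. -/
structure IsTestFunction {l : ℝ} (Ω : Set (Cone l)) (φ : Cone l → ℝ) : Prop where
  continuous : Continuous φ
  compactSupport : HasCompactSupport φ
  support_subset : tsupport φ ⊆ Ω
  smooth : ContDiffOn ℝ (⊤ : ℕ∞) (fun p => φ (polar l p)) (Ioi (0 : ℝ) ×ˢ (univ : Set ℝ))
  bounded : ∃ C : ℝ, ∀ p : ℝ × ℝ, 0 < p.1 →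
    |fderiv ℝ (fun q => φ (polar l q)) p (1, 0)| ≤ C ∧
    |fderiv ℝ (fun q => φ (polar l q)) p (0, 1)| ≤ C * p.1

/-- `w ∈ H¹₀(Ω)`, the closure of the test functions in `H¹(Ω)`. -/
def MemH10 {l : ℝ} (Ω : Set (Cone l)) (w : Cone l → ℝ) : Prop :=
  MemH1 Ω w ∧ ∃ φ : ℕ → Cone l → ℝ, (∀ n, IsTestFunction Ω (φ n)) ∧
    Tendsto (fun n => eLpNorm (w - φ n) 2 ((area l).restrict Ω)) atTop (𝓝 0) ∧
    Tendsto (fun n => eLpNorm (weakGrad Ω (w - φ n)) 2 ((area l).restrict Ω)) atTop (𝓝 0)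

/-- `J(u, Ω, a, b) = ∫_Ω |Du|² + a χ_{u > 0} + b χ_{u < 0}`, for `u ∈ H¹(Ω)`. -/
noncomputable def J {l : ℝ} (Ω : Set (Cone l)) (a b : ℝ≥0) (u : Cone l → ℝ) : ℝ≥0∞ :=
  ∫⁻ x in Ω, (‖weakGrad Ω u x‖ₑ ^ 2 + {y | 0 < u y}.indicator (fun _ => (a : ℝ≥0∞)) x
    + {y | u y < 0}.indicator (fun _ => (b : ℝ≥0∞)) x) ∂(area l)

/-- `u` minimizes `J(·, Ω, a, b)` among the functions of `H¹(Ω)` with its own boundary values. -/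
def IsMinimizer {l : ℝ} (Ω : Set (Cone l)) (a b : ℝ≥0) (u : Cone l → ℝ) : Prop :=
  MemH1 Ω u ∧ J Ω a b u < ⊤ ∧ ∀ v, MemH1 Ω v → MemH10 Ω (v - u) → J Ω a b u ≤ J Ω a b v

/-- The positive phases of `u` in `Ω`: the connected components of `{x ∈ Ω | u x > 0}`. -/
def positivePhases {l : ℝ} (Ω : Set (Cone l)) (u : Cone l → ℝ) : Set (Set (Cone l)) :=
  {A | ∃ x ∈ {y ∈ Ω | 0 < u y}, A = connectedComponentIn {y ∈ Ω | 0 < u y} x}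

/-- The sector `{|θ - α| < π}` of the cone, without the vertex. -/
def sector (l α : ℝ) : Set (Cone l) :=
  {x | ∃ r θ : ℝ, 0 < r ∧ |θ - α| < Real.pi ∧ x = polar l (r, θ)}

end Cone

/-! The proof is a calibration. Put $L=l/k$; part (1) is the case $k=2$. In both parts $L\ge 2\pi$,
and $u$ is a sum of half-plane functions supported around the rays $\theta=jL$. On the cone minus
its vertex there is a field $X=a(\theta)\,\partial_r+b(\theta)\,r^{-1}\partial_\theta$ with
continuous coefficients, $|X|=1$, $\operatorname{div}X=0$ (that is, $b'=-a$), and $X=Du$ on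
$\{u>0\}$. Across a half-plane of $u$ the coefficient $b$ falls from $1$ to $-1$. Periodicity
requires it to rise again, which it does across an opposite half-plane centred at $L/2$ modulo $L$;
in between, $a=0$ and $b=\pm1$. Both half-planes, of opening $\pi$ each, fit into one period because
$L\ge 2\pi$.

Let $H=\chi_{(0,\infty)}$. Since $|X|=1$ and $H^2=H$, one has
$|Dv|^2+H(v)=|Dv-H(v)X|^2+2H(v)\,X\cdot Dv$ (`energy_eq`). The last term is $2X\cdot D(v^+)$, the
flux of a divergence-free field, so its integral depends only on the boundary values of $v$
(`integral_heaviside_mul_inner_field_eq`). As $Du=H(u)X$, this gives $J(v)=J(u)+\int|Dv-H(v)X|^2$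
(`energy_eq_add`), hence minimality, with no sign condition on $v$.

For uniqueness, $J(v)\le J(u)$ forces $Dv=H(v)X$, so $D(v-u)=(H(v)-H(u))X$. Let $T$ be the
truncation to $[-1,1]$. The flux argument with zero boundary values shows that $T(v-u)\,X\cdot
D(v-u)=T(v-u)(H(v)-H(u))$ has integral zero. It is nonnegative, and vanishes only where $H(v)=H(u)$;
so $D(v-u)=0$, and Poincaré's inequality gives $v=u$ (`ae_eq_halfPlanes`).

The integral identities are proved for the class `HasGradientOffRays`, which contains $u$ and the
test functions and is stable under sums and under composition with $C^1$ functions with bounded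
derivative. There they reduce to the fundamental theorem of calculus on coordinate lines, and they
pass to $H^1$ by approximation. The positive phases are $k$ disjoint open connected half-disks with
the vertex in their closures. -/

namespace Cone

/-! ### Polar coordinates -/

theorem radius_polar (l : ℝ) (p : ℝ × ℝ) : radius (polar l p) = max p.1 0 :=
  Real.coe_toNNReal' p.1

theorem radius_polar_of_pos {l : ℝ} {p : ℝ × ℝ} (h : 0 < p.1) : radius (polar l p) = p.1 := by
  rw [radius_polar, max_eq_left h.le]

theorem radius_nonneg {l : ℝ} (x : Cone l) : 0 ≤ radius x := by
  induction x using Quotient.inductionOn with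
  | h p => exact p.1.2

theorem continuous_radius {l : ℝ} : Continuous (radius : Cone l → ℝ) :=
  Continuous.quotient_lift (by fun_prop) _

theorem isOpen_ball (l R : ℝ) : IsOpen (ball l R) :=
  isOpen_lt continuous_radius continuous_const

theorem measurableSet_ball (l R : ℝ) : MeasurableSet (ball l R) :=
  (isOpen_ball l R).measurableSet

theorem polar_surjective (l : ℝ) : Function.Surjective (polar l) := by
  intro x
  induction x using Quotient.inductionOn with
  | h p => exact ⟨(p.1, p.2), by simp only [polar, Real.toNNReal_coe, Prod.mk.eta]; rfl⟩

/-- For $r\ge 0$ this is the defining projection, so openness and continuity on the cone can be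
tested in the coordinates $(r,\theta)$. -/
theorem isQuotientMap_polar_coe (l : ℝ) :
    IsQuotientMap (fun q : ℝ≥0 × ℝ => polar l (q.1, q.2)) := by
  have h : (fun q : ℝ≥0 × ℝ => polar l (q.1, q.2)) = Quotient.mk (coneSetoid l) := by
    funext q
    simp only [polar, Real.toNNReal_coe, Prod.mk.eta]
    rfl
  rw [h]
  exact isQuotientMap_quotient_mk'

theorem coe_addCircle_eq_iff {l x y : ℝ} :
    (x : AddCircle l) = y ↔ ∃ n : ℤ, x = y + n * l := by
  rw [← sub_eq_zero, ← AddCircle.coe_sub, AddCircle.coe_eq_zero_iff]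
  exact exists_congr fun n => by
    rw [zsmul_eq_mul, eq_sub_iff_add_eq', eq_comm]

theorem polar_eq_polar_iff {l r s θ η : ℝ} (hr : 0 < r) (hs : 0 < s) :
    polar l (r, θ) = polar l (s, η) ↔ r = s ∧ ∃ n : ℤ, η = θ + n * l := by
  have h : polar l (r, θ) = polar l (s, η) ↔
      (r.toNNReal = s.toNNReal ∧ (r.toNNReal = 0 ∨ ∃ n : ℤ, η = θ + n * l)) := Quotient.eq
  rw [h, Real.toNNReal_eq_toNNReal_iff hr.le hs.le, Real.toNNReal_eq_zero]
  simp [hr.not_ge]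

theorem polar_add_int_mul (l r θ : ℝ) (n : ℤ) : polar l (r, θ + n * l) = polar l (r, θ) :=
  (Quotient.sound ⟨rfl, Or.inr ⟨n, rfl⟩⟩ : polar l (r, θ) = polar l (r, θ + n * l)).symm

theorem polar_of_nonpos {l r : ℝ} (θ : ℝ) (hr : r ≤ 0) : polar l (r, θ) = vertex l :=
  Quotient.sound ⟨by simp [Real.toNNReal_of_nonpos hr], Or.inl (by
    simp [Real.toNNReal_of_nonpos hr])⟩

theorem mem_ball_polar {l R : ℝ} {p : ℝ × ℝ} (h : 0 < p.1) : polar l p ∈ ball l R ↔ p.1 < R := by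
  change radius (polar l p) < R ↔ _
  rw [radius_polar_of_pos h]

/-- The angle of a point, modulo the length of the cone. At the vertex the value is `0`. -/
noncomputable def angle {l : ℝ} (x : Cone l) : AddCircle l :=
  if radius x = 0 then 0 else ((Quotient.out x).2 : AddCircle l)

theorem angle_polar {l r : ℝ} (θ : ℝ) (hr : 0 < r) : angle (polar l (r, θ)) = (θ : AddCircle l) := by
  rw [angle, if_neg (by rw [radius_polar_of_pos hr]; exact hr.ne')]
  obtain ⟨-, h | ⟨n, hn⟩⟩ := Quotient.exact (Quotient.out_eq (polar l (r, θ)))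
  · exfalso
    have h1 : radius (polar l (r, θ)) = ((polar l (r, θ)).out.1 : ℝ) := by
      conv_lhs => rw [← Quotient.out_eq (polar l (r, θ))]
      rfl
    rw [h, radius_polar_of_pos hr] at h1
    exact hr.ne' h1
  · have hn' : θ = (polar l (r, θ)).out.2 + n * l := hn
    conv_rhs => rw [hn']
    rw [AddCircle.coe_add, ← zsmul_eq_mul, AddCircle.coe_zsmul, AddCircle.coe_period, smul_zero,
      add_zero]

/-- This is the continuity of `angle` off the vertex; the value at the vertex is a convention and is
discontinuous in general. -/
theorem isOpen_setOf_angle_mem {l : ℝ} {V : Set (AddCircle l)} (hV : IsOpen V) :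
    IsOpen {x : Cone l | 0 < radius x ∧ angle x ∈ V} := by
  rw [← (isQuotientMap_polar_coe l).isOpen_preimage]
  have h : (fun q : ℝ≥0 × ℝ => polar l (q.1, q.2)) ⁻¹' {x : Cone l | 0 < radius x ∧ angle x ∈ V} =
      {q : ℝ≥0 × ℝ | 0 < q.1 ∧ (q.2 : AddCircle l) ∈ V} := by
    ext q
    simp only [mem_preimage, mem_ofPred_eq]
    rw [radius_polar, max_eq_left (show (0 : ℝ) ≤ ((q.1 : ℝ), q.2).1 from q.1.2), NNReal.coe_pos]
    exact and_congr_right fun h => by rw [angle_polar _ (NNReal.coe_pos.2 h)]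
  rw [h]
  exact (isOpen_lt continuous_const continuous_fst).inter
    (hV.preimage ((AddCircle.continuous_mk' l).comp continuous_snd))

theorem measurable_angle {l : ℝ} : Measurable (angle : Cone l → AddCircle l) := by
  refine measurable_of_isOpen fun V hV => ?_
  have h0 : MeasurableSet {x : Cone l | radius x = 0} :=
    (isClosed_eq continuous_radius continuous_const).measurableSet
  have h : angle ⁻¹' V = {x : Cone l | 0 < radius x ∧ angle x ∈ V} ∪
      ({x : Cone l | radius x = 0} ∩ {_x | (0 : AddCircle l) ∈ V}) := by
    ext x
    by_cases hx : radius x = 0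
    · simp [angle, hx]
    · simp [hx, (radius_nonneg x).lt_of_ne' hx]
  rw [h]
  exact (isOpen_setOf_angle_mem hV).measurableSet.union (h0.inter (MeasurableSet.const _))

section Coords

variable {l : ℝ} [Fact (0 < l)]

/-- Polar coordinates of a point, with the angle in `(0, l]`. -/
noncomputable def coords (x : Cone l) : ℝ × ℝ :=
  (radius x, (AddCircle.equivIoc l 0 (angle x) : ℝ))

theorem measurable_coords : Measurable (coords : Cone l → ℝ × ℝ) :=
  continuous_radius.measurable.prodMk (measurable_subtype_coe.comp
    ((AddCircle.measurableEquivIoc l 0).measurable.comp measurable_angle))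

theorem coords_polar_of_mem {r θ : ℝ} (hr : 0 < r) (hθ : θ ∈ Ioc 0 l) :
    coords (polar l (r, θ)) = (r, θ) := by
  rw [coords, radius_polar_of_pos hr, angle_polar _ hr,
    AddCircle.equivIoc_coe_of_mem (by simpa using hθ)]

theorem exists_coords_polar {r : ℝ} (θ : ℝ) (hr : 0 < r) :
    ∃ n : ℤ, coords (polar l (r, θ)) = (r, θ + n * l) := by
  have h : (((AddCircle.equivIoc l 0 (θ : AddCircle l) : ℝ)) : AddCircle l) = (θ : AddCircle l) :=
    AddCircle.coe_equivIoc
  obtain ⟨n, hn⟩ := coe_addCircle_eq_iff.1 h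
  exact ⟨n, by rw [coords, radius_polar_of_pos hr, angle_polar _ hr, hn]⟩

theorem polar_coords (x : Cone l) : polar l (coords x) = x := by
  obtain ⟨⟨r, θ⟩, rfl⟩ := polar_surjective l x
  rcases lt_or_ge 0 r with hr | hr
  · obtain ⟨n, hn⟩ := exists_coords_polar (l := l) θ hr
    rw [hn, polar_add_int_mul]
  · rw [polar_of_nonpos θ hr]
    exact polar_of_nonpos _ (by simp [vertex, radius_polar])

end Coords

/-! ### The area measure -/

/-- The measure `r dr dθ` on `(0, ∞) × (0, l]`. -/
noncomputable def polarMeasure (l : ℝ) : Measure (ℝ × ℝ) :=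
  (volume.restrict (Ioi (0 : ℝ) ×ˢ Ioc (0 : ℝ) l)).withDensity (fun p => ENNReal.ofReal p.1)

theorem area_eq_map (l : ℝ) : area l = (polarMeasure l).map (polar l) := rfl

theorem polarMeasure_absolutelyContinuous (l : ℝ) :
    polarMeasure l ≪ volume.restrict (Ioi (0 : ℝ) ×ˢ Ioc (0 : ℝ) l) :=
  withDensity_absolutelyContinuous _ _

theorem measurable_polar (l : ℝ) : Measurable (polar l) := (continuous_polar l).measurable

theorem ae_polarMeasure_mem (l : ℝ) : ∀ᵐ p ∂polarMeasure l, p ∈ Ioi (0 : ℝ) ×ˢ Ioc (0 : ℝ) l :=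
  (polarMeasure_absolutelyContinuous l).ae_le
    (ae_restrict_mem (measurableSet_Ioi.prod measurableSet_Ioc))

theorem integral_ball {l : ℝ} {f : Cone l → ℝ} (hf : AEStronglyMeasurable f (area l)) (R : ℝ) :
    ∫ x in ball l R, f x ∂area l = ∫ p in Ioo 0 R ×ˢ Ioc 0 l, p.1 * f (polar l p) := by
  have hm : MeasurableSet (polar l ⁻¹' ball l R) := measurable_polar l (measurableSet_ball l R)
  rw [area_eq_map] at hf ⊢
  rw [setIntegral_map (measurableSet_ball l R) hf (measurable_polar l).aemeasurable, polarMeasure,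
    setIntegral_withDensity_eq_setIntegral_toReal_smul (by fun_prop) (by simp) _ hm,
    Measure.restrict_restrict hm]
  have hs : polar l ⁻¹' ball l R ∩ Ioi (0 : ℝ) ×ˢ Ioc (0 : ℝ) l = Ioo 0 R ×ˢ Ioc 0 l := by
    ext p
    simp only [mem_inter_iff, mem_preimage, mem_prod, mem_Ioi, mem_Ioo]
    constructor
    · rintro ⟨h, h0, h1⟩
      exact ⟨⟨h0, (mem_ball_polar h0).1 h⟩, h1⟩
    · rintro ⟨⟨h0, h⟩, h1⟩
      exact ⟨(mem_ball_polar h0).2 h, h0, h1⟩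
  rw [hs]
  refine setIntegral_congr_fun (measurableSet_Ioo.prod measurableSet_Ioc) fun p hp => ?_
  simp [ENNReal.toReal_ofReal hp.1.1.le]

section Area

variable {l : ℝ} [Fact (0 < l)]

/-- `coords` inverts `polar` on the fundamental domain $(0,\infty)\times(0,l]$, which carries
`polarMeasure`. This transfers almost-everywhere statements and measurability between the cone and
the half-plane of coordinates. -/
theorem map_coords_area : (area l).map coords = polarMeasure l := by
  rw [area_eq_map, Measure.map_map measurable_coords (measurable_polar l)]
  refine (Measure.map_congr ?_).trans Measure.map_id
  filter_upwards [ae_polarMeasure_mem l] with p hp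
  exact coords_polar_of_mem hp.1 hp.2

theorem ae_area_of_ae_polarMeasure {P : Cone l → Prop}
    (h : ∀ᵐ p ∂polarMeasure l, P (polar l p)) : ∀ᵐ x ∂area l, P x := by
  rw [← map_coords_area] at h
  filter_upwards [ae_of_ae_map measurable_coords.aemeasurable h] with x hx
  rwa [polar_coords] at hx

theorem ae_restrict_area_of_ae_lift {Ω : Set (Cone l)} (hΩ : MeasurableSet Ω) {P : Cone l → Prop}
    (h : ∀ᵐ p ∂(volume : Measure (ℝ × ℝ)), p ∈ lift Ω → P (polar l p)) :
    ∀ᵐ x ∂(area l).restrict Ω, P x := by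
  rw [ae_restrict_iff' hΩ]
  refine ae_area_of_ae_polarMeasure ?_
  filter_upwards [ae_polarMeasure_mem l,
    ((polarMeasure_absolutelyContinuous l).trans Measure.restrict_le_self.absolutelyContinuous).ae_le
      h] with p hp hP hpΩ
  exact hP ⟨hp.1, hpΩ⟩

theorem aestronglyMeasurable_area {E : Type*} [TopologicalSpace E] {f : Cone l → E}
    (h : AEStronglyMeasurable (fun p => f (polar l p)) (volume.restrict (Ioi (0 : ℝ) ×ˢ univ))) :
    AEStronglyMeasurable f (area l) := by
  have h1 : AEStronglyMeasurable (fun p => f (polar l p)) (polarMeasure l) :=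
    (h.mono_measure (Measure.restrict_mono (prod_mono subset_rfl (subset_univ _)) le_rfl)).mono_ac
      (polarMeasure_absolutelyContinuous l)
  rw [← map_coords_area] at h1
  exact (h1.comp_measurable measurable_coords).congr
    (Eventually.of_forall fun x => by simp [polar_coords])

instance isFiniteMeasure_restrict_ball (R : ℝ) : IsFiniteMeasure ((area l).restrict (ball l R)) := by
  constructor
  rw [Measure.restrict_apply_univ, area_eq_map,
    Measure.map_apply (measurable_polar l) (measurableSet_ball l R), polarMeasure,
    withDensity_apply _ (measurable_polar l (measurableSet_ball l R)), Measure.restrict_restrict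
      (measurable_polar l (measurableSet_ball l R))]
  calc ∫⁻ p in polar l ⁻¹' ball l R ∩ Ioi (0 : ℝ) ×ˢ Ioc (0 : ℝ) l, ENNReal.ofReal p.1
      ≤ ∫⁻ p in polar l ⁻¹' ball l R ∩ Ioi (0 : ℝ) ×ˢ Ioc (0 : ℝ) l, ENNReal.ofReal R := by
        refine setLIntegral_mono measurable_const fun p hp => ?_
        exact ENNReal.ofReal_le_ofReal ((mem_ball_polar hp.2.1).1 hp.1).le
    _ ≤ ∫⁻ p in Icc 0 R ×ˢ Icc 0 l, ENNReal.ofReal R := by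
        refine lintegral_mono_set fun p hp => ?_
        exact ⟨⟨(mem_Ioi.1 hp.2.1).le, ((mem_ball_polar hp.2.1).1 hp.1).le⟩,
          Ioc_subset_Icc_self hp.2.2⟩
    _ < ⊤ := by
        rw [setLIntegral_const]
        exact ENNReal.mul_lt_top ENNReal.ofReal_lt_top
          (isCompact_Icc.prod isCompact_Icc).measure_lt_top

end Area

/-! ### Linearity and uniqueness of weak gradients -/

theorem integrable_mul_of_locallyIntegrableOn {s : Set (ℝ × ℝ)} {f ψ : ℝ × ℝ → ℝ}
    (hf : LocallyIntegrableOn f s volume) (hψ : Continuous ψ) (hc : HasCompactSupport ψ)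
    (hs : tsupport ψ ⊆ s) : Integrable (fun p => f p * ψ p) := by
  have h1 : IntegrableOn f (tsupport ψ) volume := hf.integrableOn_compact_subset hs hc
  have h2 : IntegrableOn (fun p => f p * ψ p) (tsupport ψ) volume :=
    h1.mul_continuousOn hψ.continuousOn hc
  rwa [integrableOn_iff_integrable_of_support_subset] at h2
  intro p hp
  exact subset_tsupport ψ fun h => hp (by simp [h])

theorem locallyIntegrableOn_apply {s : Set (ℝ × ℝ)} {G : ℝ × ℝ → EuclideanSpace ℝ (Fin 2)}
    (hG : LocallyIntegrableOn G s volume) (i : Fin 2) :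
    LocallyIntegrableOn (fun p => G p i) s volume := by
  intro p hp
  obtain ⟨t, ht, h⟩ := hG p hp
  exact ⟨t, ht, (EuclideanSpace.proj (𝕜 := ℝ) i).integrable_comp h⟩

theorem continuous_fderiv_apply {ψ : ℝ × ℝ → ℝ} (hψ : ContDiff ℝ (⊤ : ℕ∞) ψ) (v : ℝ × ℝ) :
    Continuous fun p => fderiv ℝ ψ p v :=
  (hψ.continuous_fderiv (by simp)).clm_apply continuous_const

theorem hasCompactSupport_fderiv_apply {ψ : ℝ × ℝ → ℝ} (hc : HasCompactSupport ψ) (v : ℝ × ℝ) :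
    HasCompactSupport fun p => fderiv ℝ ψ p v :=
  hc.fderiv_apply (𝕜 := ℝ) v

theorem tsupport_fderiv_apply {ψ : ℝ × ℝ → ℝ} (v : ℝ × ℝ) :
    tsupport (fun p => fderiv ℝ ψ p v) ⊆ tsupport ψ :=
  tsupport_fderiv_apply_subset ℝ v

variable {l : ℝ} {Ω : Set (Cone l)} {u u' : Cone l → ℝ} {G G' : Cone l → EuclideanSpace ℝ (Fin 2)}

theorem integrable_mul_radial (h : LocallyIntegrableOn (fun p => G (polar l p)) (lift Ω) volume)
    {ψ : ℝ × ℝ → ℝ} (hψ : Continuous ψ) (hc : HasCompactSupport ψ) (hs : tsupport ψ ⊆ lift Ω) :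
    Integrable fun p => G (polar l p) 0 * ψ p :=
  integrable_mul_of_locallyIntegrableOn (locallyIntegrableOn_apply h 0) hψ hc hs

theorem integrable_mul_angular (h : LocallyIntegrableOn (fun p => G (polar l p)) (lift Ω) volume)
    {ψ : ℝ × ℝ → ℝ} (hψ : Continuous ψ) (hc : HasCompactSupport ψ) (hs : tsupport ψ ⊆ lift Ω) :
    Integrable fun p => p.1 * G (polar l p) 1 * ψ p := by
  have h1 := integrable_mul_of_locallyIntegrableOn (locallyIntegrableOn_apply h 1)
    (continuous_fst.mul hψ) (hc.mul_left (f := Prod.fst)) ((tsupport_mul_subset_right).trans hs)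
  refine h1.congr (Eventually.of_forall fun p => ?_)
  simp only [Pi.mul_apply]
  ring

theorem HasWeakGradient.sub (h : HasWeakGradient Ω u G) (h' : HasWeakGradient Ω u' G') :
    HasWeakGradient Ω (u - u') (G - G') where
  locInt := h.locInt.sub h'.locInt
  locInt_grad := h.locInt_grad.sub h'.locInt_grad
  radial ψ hψ hc hs := by
    have e := integral_sub
      (integrable_mul_of_locallyIntegrableOn h.locInt (continuous_fderiv_apply hψ (1, 0))
        (hasCompactSupport_fderiv_apply hc _) ((tsupport_fderiv_apply _).trans hs))
      (integrable_mul_of_locallyIntegrableOn h'.locInt (continuous_fderiv_apply hψ (1, 0))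
        (hasCompactSupport_fderiv_apply hc _) ((tsupport_fderiv_apply _).trans hs))
    have e' := integral_sub (integrable_mul_radial h.locInt_grad hψ.continuous hc hs)
      (integrable_mul_radial h'.locInt_grad hψ.continuous hc hs)
    rw [h.radial ψ hψ hc hs, h'.radial ψ hψ hc hs] at e
    simp only [Pi.sub_apply, PiLp.sub_apply, sub_mul]
    rw [e, e']
    ring
  angular ψ hψ hc hs := by
    have e := integral_sub
      (integrable_mul_of_locallyIntegrableOn h.locInt (continuous_fderiv_apply hψ (0, 1))
        (hasCompactSupport_fderiv_apply hc _) ((tsupport_fderiv_apply _).trans hs))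
      (integrable_mul_of_locallyIntegrableOn h'.locInt (continuous_fderiv_apply hψ (0, 1))
        (hasCompactSupport_fderiv_apply hc _) ((tsupport_fderiv_apply _).trans hs))
    have e' := integral_sub (integrable_mul_angular h.locInt_grad hψ.continuous hc hs)
      (integrable_mul_angular h'.locInt_grad hψ.continuous hc hs)
    rw [h.angular ψ hψ hc hs, h'.angular ψ hψ hc hs] at e
    simp only [Pi.sub_apply, PiLp.sub_apply, sub_mul, mul_sub]
    rw [e, e']
    ring

/-- The fundamental lemma of the calculus of variations in the covering; the factor $r$ in the
angular equation is divided out since $r>0$ there. It allows `weakGrad`, which is defined by choice,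
to be replaced by any explicit gradient. -/
theorem HasWeakGradient.ae_eq [Fact (0 < l)] (hΩ : IsOpen Ω) (h : HasWeakGradient Ω u G)
    (h' : HasWeakGradient Ω u G') : G =ᵐ[(area l).restrict Ω] G' := by
  have hl : IsOpen (lift Ω) :=
    (isOpen_lt continuous_const continuous_fst).inter (hΩ.preimage (continuous_polar l))
  have hd := h.sub h'
  have h0 : ∀ᵐ p ∂(volume : Measure (ℝ × ℝ)), p ∈ lift Ω → (G - G') (polar l p) 0 = 0 := by
    refine hl.ae_eq_zero_of_integral_contDiff_smul_eq_zero
      (locallyIntegrableOn_apply hd.locInt_grad 0) fun ψ hψ hc hs => ?_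
    have := hd.radial ψ hψ hc hs
    rw [sub_self] at this
    simpa [mul_comm] using this
  have h1 : ∀ᵐ p ∂(volume : Measure (ℝ × ℝ)), p ∈ lift Ω → p.1 * (G - G') (polar l p) 1 = 0 := by
    refine hl.ae_eq_zero_of_integral_contDiff_smul_eq_zero
      ((locallyIntegrableOn_apply hd.locInt_grad 1).continuousOn_mul continuousOn_fst
        hl.isLocallyClosed) fun ψ hψ hc hs => ?_
    have := hd.angular ψ hψ hc hs
    rw [sub_self] at this
    simpa [mul_comm] using this
  refine ae_restrict_area_of_ae_lift hΩ.measurableSet ?_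
  filter_upwards [h0, h1] with p h0 h1 hp
  ext i
  have e0 := h0 hp
  have e1 := (mul_eq_zero.1 (h1 hp)).resolve_left hp.1.ne'
  fin_cases i
  · simpa [sub_eq_zero] using e0
  · simpa [sub_eq_zero] using e1

theorem HasWeakGradient.weakGrad (h : HasWeakGradient Ω u G) :
    HasWeakGradient Ω u (weakGrad Ω u) := by
  have h' : ∃ G, HasWeakGradient Ω u G := ⟨G, h⟩
  rw [Cone.weakGrad, dif_pos h']
  exact h'.choose_spec

theorem HasWeakGradient.weakGrad_ae_eq [Fact (0 < l)] (hΩ : IsOpen Ω) (h : HasWeakGradient Ω u G) :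
    Cone.weakGrad Ω u =ᵐ[(area l).restrict Ω] G :=
  h.weakGrad.ae_eq hΩ h

theorem MemH1.hasWeakGradient (h : MemH1 Ω u) : HasWeakGradient Ω u (Cone.weakGrad Ω u) :=
  h.2.choose_spec.1.weakGrad

theorem MemH1.memLp_weakGrad [Fact (0 < l)] (hΩ : IsOpen Ω) (h : MemH1 Ω u) :
    MemLp (Cone.weakGrad Ω u) 2 ((area l).restrict Ω) :=
  let ⟨_, hG, hL⟩ := h.2
  hL.ae_eq (hG.weakGrad_ae_eq hΩ).symm

/-! ### Functions with a bounded classical gradient off countably many rays -/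

/-- `f` is continuous and has the bounded gradient `G`, in the frame `∂_r, r⁻¹ ∂_θ`, off the vertex
and countably many rays. -/
structure HasGradientOffRays {l : ℝ} (f : Cone l → ℝ) (G : Cone l → EuclideanSpace ℝ (Fin 2)) :
    Prop where
  continuous : Continuous f
  measurable : AEStronglyMeasurable (fun p => G (polar l p))
    (volume.restrict (Ioi (0 : ℝ) ×ˢ univ))
  bounded : ∃ C, ∀ p : ℝ × ℝ, 0 < p.1 → ‖G (polar l p)‖ ≤ C
  hasDerivAt : ∃ S : Set ℝ, S.Countable ∧ ∀ r θ : ℝ, 0 < r → θ ∉ S →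
    HasDerivAt (fun r => f (polar l (r, θ))) (G (polar l (r, θ)) 0) r ∧
    HasDerivAt (fun θ => f (polar l (r, θ))) (r * G (polar l (r, θ)) 1) θ

theorem norm_toLp_pair_le (x y : ℝ) : ‖(!₂[x, y] : EuclideanSpace ℝ (Fin 2))‖ ≤ |x| + |y| := by
  rw [EuclideanSpace.norm_eq]
  refine Real.sqrt_le_iff.2 ⟨by positivity, ?_⟩
  simp only [Fin.sum_univ_two, Real.norm_eq_abs]
  simp only [Matrix.cons_val_zero, Matrix.cons_val_one]
  nlinarith [abs_nonneg x, abs_nonneg y]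

theorem abs_apply_le_norm (v : EuclideanSpace ℝ (Fin 2)) (i : Fin 2) : |v i| ≤ ‖v‖ :=
  PiLp.norm_apply_le v i

theorem fderiv_polar_add {l : ℝ} (f : Cone l → ℝ) (r θ : ℝ) (n : ℤ) :
    fderiv ℝ (fun q => f (polar l q)) (r, θ + n * l) = fderiv ℝ (fun q => f (polar l q)) (r, θ) := by
  have h : (fun q : ℝ × ℝ => f (polar l q)) = fun q => f (polar l (q + (0, n * l))) := by
    funext ⟨s, η⟩
    rw [Prod.mk_add_mk, add_zero, polar_add_int_mul]
  conv_rhs => rw [h]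
  rw [fderiv_comp_add_right (f := fun q => f (polar l q)) (0, n * l), Prod.mk_add_mk, add_zero]

theorem measurableSet_halfPlane : MeasurableSet (Ioi (0 : ℝ) ×ˢ (univ : Set ℝ)) :=
  measurableSet_Ioi.prod MeasurableSet.univ

section Smooth

variable {l : ℝ} [Fact (0 < l)]

/-- The gradient, in the frame `∂_r, r⁻¹ ∂_θ`, of a function that is smooth off the vertex. -/
noncomputable def classicalGrad (f : Cone l → ℝ) (x : Cone l) : EuclideanSpace ℝ (Fin 2) :=
  !₂[fderiv ℝ (fun q => f (polar l q)) (coords x) (1, 0),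
    (coords x).1⁻¹ * fderiv ℝ (fun q => f (polar l q)) (coords x) (0, 1)]

theorem classicalGrad_polar (f : Cone l → ℝ) {p : ℝ × ℝ} (hp : 0 < p.1) :
    classicalGrad f (polar l p) = !₂[fderiv ℝ (fun q => f (polar l q)) p (1, 0),
      p.1⁻¹ * fderiv ℝ (fun q => f (polar l q)) p (0, 1)] := by
  obtain ⟨r, θ⟩ := p
  obtain ⟨n, hn⟩ := exists_coords_polar (l := l) θ hp
  rw [classicalGrad, hn, fderiv_polar_add]

theorem IsTestFunction.hasGradientOffRays {Ω : Set (Cone l)} {φ : Cone l → ℝ}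
    (h : IsTestFunction Ω φ) : HasGradientOffRays φ (classicalGrad φ) where
  continuous := h.continuous
  measurable := by
    have hc : ∀ v : ℝ × ℝ, ContinuousOn (fun p => fderiv ℝ (fun q => φ (polar l q)) p v)
        (Ioi (0 : ℝ) ×ˢ univ) := fun v =>
      (h.smooth.continuousOn_fderiv_of_isOpen (isOpen_Ioi.prod isOpen_univ) (by simp)).clm_apply
        continuousOn_const
    have hG : ContinuousOn (fun p : ℝ × ℝ => (!₂[fderiv ℝ (fun q => φ (polar l q)) p (1, 0),
        p.1⁻¹ * fderiv ℝ (fun q => φ (polar l q)) p (0, 1)] : EuclideanSpace ℝ (Fin 2)))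
        (Ioi (0 : ℝ) ×ˢ univ) := by
      refine (PiLp.continuous_toLp 2 _).comp_continuousOn (continuousOn_pi.2 fun i => ?_)
      fin_cases i
      · exact hc _
      · exact (continuousOn_fst.inv₀ fun p hp => (mem_Ioi.1 hp.1).ne').mul (hc _)
    exact (hG.congr fun p hp => classicalGrad_polar φ hp.1).aestronglyMeasurable
      measurableSet_halfPlane
  bounded := by
    obtain ⟨C, hC⟩ := h.bounded
    refine ⟨C + C, fun p hp => ?_⟩
    rw [classicalGrad_polar φ hp]
    refine (norm_toLp_pair_le _ _).trans (add_le_add (hC p hp).1 ?_)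
    rw [abs_mul, abs_of_pos (inv_pos.2 hp), inv_mul_le_iff₀ hp, mul_comm]
    exact (hC p hp).2
  hasDerivAt := by
    refine ⟨∅, countable_empty, fun r θ hr _ => ?_⟩
    have hd : HasFDerivAt (fun q => φ (polar l q)) (fderiv ℝ (fun q => φ (polar l q)) (r, θ))
        (r, θ) :=
      ((h.smooth.contDiffAt ((isOpen_Ioi.prod isOpen_univ).mem_nhds
        (⟨hr, mem_univ _⟩ : (r, θ) ∈ Ioi (0 : ℝ) ×ˢ univ))).differentiableAt (by simp)).hasFDerivAt
    rw [classicalGrad_polar φ (p := (r, θ)) hr]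
    constructor
    · exact hd.comp_hasDerivAt r ((hasDerivAt_id r).prodMk (hasDerivAt_const r θ))
    · have := hd.comp_hasDerivAt θ ((hasDerivAt_const θ r).prodMk (hasDerivAt_id θ))
      simpa [hr.ne'] using! this

end Smooth

namespace HasGradientOffRays

variable {l : ℝ} {f f' : Cone l → ℝ} {G G' : Cone l → EuclideanSpace ℝ (Fin 2)}

theorem zero : HasGradientOffRays (0 : Cone l → ℝ) 0 where
  continuous := continuous_const
  measurable := aestronglyMeasurable_const
  bounded := ⟨0, by simp⟩
  hasDerivAt := ⟨∅, countable_empty, fun r θ _ _ => by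
    simpa using ⟨hasDerivAt_const r (0 : ℝ), hasDerivAt_const θ (0 : ℝ)⟩⟩

theorem add (h : HasGradientOffRays f G) (h' : HasGradientOffRays f' G') :
    HasGradientOffRays (f + f') (G + G') where
  continuous := h.continuous.add h'.continuous
  measurable := h.measurable.add h'.measurable
  bounded := by
    obtain ⟨C, hC⟩ := h.bounded
    obtain ⟨C', hC'⟩ := h'.bounded
    exact ⟨C + C', fun p hp => norm_add_le_of_le (hC p hp) (hC' p hp)⟩
  hasDerivAt := by
    obtain ⟨S, hS, hd⟩ := h.hasDerivAt
    obtain ⟨S', hS', hd'⟩ := h'.hasDerivAt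
    refine ⟨S ∪ S', hS.union hS', fun r θ hr hθ => ?_⟩
    rw [mem_union, not_or] at hθ
    refine ⟨(hd r θ hr hθ.1).1.add (hd' r θ hr hθ.2).1, ?_⟩
    simpa [mul_add] using! (hd r θ hr hθ.1).2.add (hd' r θ hr hθ.2).2

/-- Used with $F$ a primitive of a cutoff $g$: then $g(f)\,Df$ is the gradient of $F(f)$, so
weighted fluxes become plain fluxes. -/
theorem comp (h : HasGradientOffRays f G) {F g : ℝ → ℝ} (hF : ∀ t, HasDerivAt F (g t) t)
    (hg : Continuous g) {B : ℝ} (hB : ∀ t, |g t| ≤ B) :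
    HasGradientOffRays (fun x => F (f x)) (fun x => g (f x) • G x) where
  continuous := (continuous_iff_continuousAt.2 fun t => (hF t).continuousAt).comp h.continuous
  measurable := (((hg.comp h.continuous).comp
    (continuous_polar l)).aestronglyMeasurable).smul h.measurable
  bounded := by
    obtain ⟨C, hC⟩ := h.bounded
    refine ⟨B * C, fun p hp => ?_⟩
    rw [norm_smul]
    exact mul_le_mul (hB _) (hC p hp) (norm_nonneg _) ((abs_nonneg _).trans (hB 0))
  hasDerivAt := by
    obtain ⟨S, hS, hd⟩ := h.hasDerivAt
    refine ⟨S, hS, fun r θ hr hθ => ?_⟩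
    refine ⟨(hF _).comp r (hd r θ hr hθ).1, ?_⟩
    have := (hF _).comp θ (hd r θ hr hθ).2
    simpa [mul_left_comm] using! this

theorem neg (h : HasGradientOffRays f G) : HasGradientOffRays (-f) (-G) := by
  have := h.comp (F := fun t => -t) (g := fun _ => -1) (fun t => (hasDerivAt_id t).neg)
    continuous_const (B := 1) (by simp)
  simpa using! this

theorem sub (h : HasGradientOffRays f G) (h' : HasGradientOffRays f' G') :
    HasGradientOffRays (f - f') (G - G') := by
  rw [sub_eq_add_neg, sub_eq_add_neg]
  exact h.add h'.neg

theorem continuous_polar (h : HasGradientOffRays f G) : Continuous fun p => f (polar l p) :=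
  h.continuous.comp (Cone.continuous_polar l)

theorem measurable_apply (h : HasGradientOffRays f G) (i : Fin 2) :
    AEStronglyMeasurable (fun p => G (polar l p) i) (volume.restrict (Ioi (0 : ℝ) ×ˢ univ)) :=
  (EuclideanSpace.proj (𝕜 := ℝ) i).continuous.comp_aestronglyMeasurable h.measurable

theorem locallyIntegrableOn (h : HasGradientOffRays f G) (Ω : Set (Cone l)) :
    LocallyIntegrableOn (fun p => G (polar l p)) (lift Ω) volume := by
  obtain ⟨C, hC⟩ := h.bounded
  have h1 : LocallyIntegrableOn (fun p => G (polar l p)) (Ioi (0 : ℝ) ×ˢ univ) volume := by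
    intro p hp
    refine ⟨Ioi (0 : ℝ) ×ˢ univ ∩ Metric.ball p 1,
      inter_mem_nhdsWithin _ (Metric.ball_mem_nhds p one_pos), ?_⟩
    have hm : MeasurableSet (Ioi (0 : ℝ) ×ˢ univ ∩ Metric.ball p 1) :=
      measurableSet_halfPlane.inter Metric.isOpen_ball.measurableSet
    refine ⟨h.measurable.mono_measure (Measure.restrict_mono inter_subset_left le_rfl),
      HasFiniteIntegral.restrict_of_bounded (C := C)
        ((measure_mono inter_subset_right).trans_lt measure_ball_lt_top) ?_⟩
    exact (ae_restrict_mem hm).mono fun q hq => hC q hq.1.1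
  exact h1.mono_set fun p hp => ⟨hp.1, mem_univ _⟩

end HasGradientOffRays

/-! ### Integration by parts on coordinate lines -/

theorem integral_prod_eq_zero_of_left {μ ν : Measure ℝ} [SFinite μ] [SFinite ν] {h : ℝ × ℝ → ℝ}
    (hi : Integrable h (μ.prod ν))
    (h0 : ∀ᵐ θ ∂ν, Integrable (fun r => h (r, θ)) μ → ∫ r, h (r, θ) ∂μ = 0) :
    ∫ p, h p ∂(μ.prod ν) = 0 := by
  rw [integral_prod_symm _ hi]
  refine integral_eq_zero_of_ae ?_
  filter_upwards [h0, hi.prod_left_ae] with θ h1 h2 using h1 h2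

theorem integral_prod_eq_zero_of_right {μ ν : Measure ℝ} [SFinite μ] [SFinite ν] {h : ℝ × ℝ → ℝ}
    (hi : Integrable h (μ.prod ν))
    (h0 : ∀ᵐ r ∂μ, Integrable (fun θ => h (r, θ)) ν → ∫ θ, h (r, θ) ∂ν = 0) :
    ∫ p, h p ∂(μ.prod ν) = 0 := by
  rw [integral_prod _ hi]
  refine integral_eq_zero_of_ae ?_
  filter_upwards [h0, hi.prod_right_ae] with θ h1 h2 using h1 h2

theorem integral_eq_zero_of_hasDerivAt_off_countable {f f' : ℝ → ℝ} {S : Set ℝ} (hS : S.Countable)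
    (hf : Continuous f) (hd : ∀ x ∉ S, HasDerivAt f (f' x) x) (hi : Integrable f') {N : ℝ}
    (h0 : ∀ x, N ≤ |x| → f x = 0) (h0' : ∀ x, N ≤ |x| → f' x = 0) : ∫ x, f' x = 0 := by
  have hN : N ≤ |max N 0| := (le_max_left _ _).trans (le_abs_self _)
  have h1 : ∫ x in (-max N 0)..(max N 0), f' x = f (max N 0) - f (-max N 0) :=
    integral_eq_of_hasDerivAt_off_countable f f' hS hf.continuousOn (fun x hx => hd x hx.2)
      hi.intervalIntegrable
  rw [h0 _ hN, h0 _ (by rwa [abs_neg]), sub_zero] at h1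
  rw [← h1, intervalIntegral.integral_of_le (by simp), setIntegral_eq_integral_of_forall_compl_eq_zero]
  intro x hx
  refine h0' x (not_lt.1 fun hx' => hx ?_)
  have := abs_lt.1 (hx'.trans_le (le_max_left N 0))
  exact ⟨this.1, this.2.le⟩

/-- Fubini and integration of the derivative of a product. For the radial derivative the exceptional
rays form a null set of angles; for the angular one they are countably many points of a circle,
harmless because $f$ is continuous. -/
theorem HasGradientOffRays.hasWeakGradient {l : ℝ} {f : Cone l → ℝ}
    {G : Cone l → EuclideanSpace ℝ (Fin 2)} (h : HasGradientOffRays f G) (Ω : Set (Cone l)) :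
    HasWeakGradient Ω f G := by
  have hloc := h.locallyIntegrableOn Ω
  obtain ⟨S, hS, hd⟩ := h.hasDerivAt
  have key : ∀ ψ : ℝ × ℝ → ℝ, HasCompactSupport ψ → ∃ N : ℝ, ∀ p : ℝ × ℝ,
      (N ≤ |p.1| ∨ N ≤ |p.2|) → p ∉ tsupport ψ := by
    intro ψ hc
    obtain ⟨N, hN⟩ := hc.isCompact.isBounded.exists_norm_le
    refine ⟨N + 1, fun p hp hm => ?_⟩
    have h1 := hN p hm
    have h2 : |p.1| ≤ ‖p‖ := norm_fst_le p
    have h3 : |p.2| ≤ ‖p‖ := norm_snd_le p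
    rcases hp with hp | hp <;> linarith
  have hz : ∀ ψ : ℝ × ℝ → ℝ, ∀ p ∉ tsupport ψ, ψ p = 0 ∧ fderiv ℝ ψ p = 0 := fun ψ p hp =>
    ⟨image_eq_zero_of_notMem_tsupport hp, image_eq_zero_of_notMem_tsupport fun hp' =>
      hp (tsupport_fderiv_subset ℝ hp')⟩
  refine ⟨(h.continuous_polar.locallyIntegrable).locallyIntegrableOn _, hloc, ?_, ?_⟩
  · intro ψ hψ hc hs
    have hI1 : Integrable fun p => f (polar l p) * fderiv ℝ ψ p (1, 0) :=
      (h.continuous_polar.mul (continuous_fderiv_apply hψ _)).integrable_of_hasCompactSupport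
        ((hasCompactSupport_fderiv_apply hc _).mul_left)
    have hI2 := integrable_mul_radial hloc hψ.continuous hc hs
    rw [eq_neg_iff_add_eq_zero, ← integral_add hI1 hI2]
    obtain ⟨N, hN⟩ := key ψ hc
    refine integral_prod_eq_zero_of_left (hI1.add hI2) ?_
    filter_upwards [hS.ae_notMem volume] with θ hθ hi
    refine integral_eq_zero_of_hasDerivAt_off_countable (f := fun r => f (polar l (r, θ)) * ψ (r, θ))
      countable_empty ?_ ?_ hi (N := N) ?_ ?_
    · exact (h.continuous_polar.mul hψ.continuous).comp (Continuous.prodMk_left θ)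
    · intro r _
      have hψd : HasDerivAt (fun r => ψ (r, θ)) (fderiv ℝ ψ (r, θ) (1, 0)) r :=
        ((hψ.differentiable (by simp)) (r, θ)).hasFDerivAt.comp_hasDerivAt r
          ((hasDerivAt_id r).prodMk (hasDerivAt_const r θ))
      by_cases hr : 0 < r
      · exact ((hd r θ hr hθ).1.mul hψd).congr_deriv (by ring)
      -- For $r\le 0$ the hypothesis on $f$ says nothing, but the support of $\psi$ lies in
      -- $\{r>0\}$, so the product vanishes near this point.
      · have hm : (r, θ) ∉ tsupport ψ := fun hm => hr (hs hm).1
        obtain ⟨e1, e2⟩ := hz ψ _ hm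
        simp only [e1, e2, mul_zero, add_zero, zero_apply]
        refine (hasDerivAt_const r (0 : ℝ)).congr_of_eventuallyEq ?_
        have : ∀ᶠ s in 𝓝 r, (s, θ) ∉ tsupport ψ :=
          (Continuous.prodMk_left θ).continuousAt.eventually
            ((isClosed_tsupport ψ).isOpen_compl.mem_nhds hm)
        filter_upwards [this] with s hs'
        rw [(hz ψ _ hs').1, mul_zero]
    · intro r hr
      simp only [(hz ψ _ (hN (r, θ) (Or.inl hr))).1, mul_zero]
    · intro r hr
      obtain ⟨e1, e2⟩ := hz ψ _ (hN (r, θ) (Or.inl hr))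
      simp [e1, e2]
  · intro ψ hψ hc hs
    have hI1 : Integrable fun p => f (polar l p) * fderiv ℝ ψ p (0, 1) :=
      (h.continuous_polar.mul (continuous_fderiv_apply hψ _)).integrable_of_hasCompactSupport
        ((hasCompactSupport_fderiv_apply hc _).mul_left)
    have hI2 := integrable_mul_angular hloc hψ.continuous hc hs
    rw [eq_neg_iff_add_eq_zero, ← integral_add hI1 hI2]
    obtain ⟨N, hN⟩ := key ψ hc
    refine integral_prod_eq_zero_of_right (hI1.add hI2) (Eventually.of_forall fun r hi => ?_)
    refine integral_eq_zero_of_hasDerivAt_off_countable (f := fun θ => f (polar l (r, θ)) * ψ (r, θ))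
      hS ?_ ?_ hi (N := N) ?_ ?_
    · exact (h.continuous_polar.mul hψ.continuous).comp (Continuous.prodMk_right r)
    · intro θ hθ
      have hψd : HasDerivAt (fun θ => ψ (r, θ)) (fderiv ℝ ψ (r, θ) (0, 1)) θ :=
        ((hψ.differentiable (by simp)) (r, θ)).hasFDerivAt.comp_hasDerivAt θ
          ((hasDerivAt_const θ r).prodMk (hasDerivAt_id θ))
      by_cases hr : 0 < r
      · exact ((hd r θ hr hθ).2.mul hψd).congr_deriv (by ring)
      · have hm : ∀ η, (r, η) ∉ tsupport ψ := fun η hm => hr (hs hm).1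
        obtain ⟨e1, e2⟩ := hz ψ _ (hm θ)
        simp only [e1, e2, mul_zero, add_zero, zero_apply]
        refine (hasDerivAt_const θ (0 : ℝ)).congr_of_eventuallyEq (Eventually.of_forall fun η => ?_)
        simp only [(hz ψ _ (hm η)).1, mul_zero]
    · intro θ hθ
      simp only [(hz ψ _ (hN (r, θ) (Or.inr hθ))).1, mul_zero]
    · intro θ hθ
      obtain ⟨e1, e2⟩ := hz ψ _ (hN (r, θ) (Or.inr hθ))
      simp [e1, e2]

/-! ### Integral identities -/

section Bounds

variable {l : ℝ} [Fact (0 < l)] {f : Cone l → ℝ} {G : Cone l → EuclideanSpace ℝ (Fin 2)}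

theorem coords_mem_of_mem_ball {R : ℝ} {x : Cone l} (hx : x ∈ ball l R) :
    coords x ∈ Icc 0 R ×ˢ Icc 0 l := by
  have h : (AddCircle.equivIoc l 0 (angle x) : ℝ) ∈ Ioc 0 l := by
    simpa only [zero_add] using (AddCircle.equivIoc l 0 (angle x)).2
  exact ⟨⟨radius_nonneg x, le_of_lt hx⟩, Ioc_subset_Icc_self h⟩

theorem exists_bound_on_ball (hf : Continuous f) (R : ℝ) : ∃ C, ∀ x ∈ ball l R, |f x| ≤ C := by
  obtain ⟨C, hC⟩ := (isCompact_Icc.prod isCompact_Icc).exists_bound_of_continuousOn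
    (s := Icc 0 R ×ˢ Icc 0 l) (hf.comp (continuous_polar l)).continuousOn
  refine ⟨C, fun x hx => ?_⟩
  have := hC _ (coords_mem_of_mem_ball hx)
  rwa [Function.comp_apply, polar_coords] at this

theorem memLp_ball_of_continuous (hf : Continuous f) (R : ℝ) (q : ℝ≥0∞) :
    MemLp f q ((area l).restrict (ball l R)) := by
  obtain ⟨C, hC⟩ := exists_bound_on_ball hf R
  exact MemLp.of_bound hf.measurable.aestronglyMeasurable C
    ((ae_restrict_mem (measurableSet_ball l R)).mono hC)

theorem HasGradientOffRays.aestronglyMeasurable_grad (h : HasGradientOffRays f G) :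
    AEStronglyMeasurable G (area l) :=
  aestronglyMeasurable_area h.measurable

theorem HasGradientOffRays.memLp_grad (h : HasGradientOffRays f G) (R : ℝ) (q : ℝ≥0∞) :
    MemLp G q ((area l).restrict (ball l R)) := by
  obtain ⟨C, hC⟩ := h.bounded
  refine MemLp.of_bound h.aestronglyMeasurable_grad.restrict C (ae_restrict_of_ae ?_)
  refine ae_area_of_ae_polarMeasure ?_
  filter_upwards [ae_polarMeasure_mem l] with p hp using hC p hp.1

theorem HasGradientOffRays.memH1 (h : HasGradientOffRays f G) (R : ℝ) : MemH1 (ball l R) f :=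
  ⟨memLp_ball_of_continuous h.continuous R 2, G, h.hasWeakGradient _, h.memLp_grad R 2⟩

end Bounds

theorem integrableOn_rect_mul {g c : ℝ × ℝ → ℝ} {C : ℝ} (R l : ℝ)
    (hg : AEStronglyMeasurable g (volume.restrict (Ioi (0 : ℝ) ×ˢ univ)))
    (hC : ∀ p : ℝ × ℝ, 0 < p.1 → |g p| ≤ C) (hc : Continuous c) :
    IntegrableOn (fun p => c p * g p) (Ioo 0 R ×ˢ Ioc 0 l) := by
  obtain ⟨B, hB⟩ := (isCompact_Icc.prod isCompact_Icc).exists_bound_of_continuousOn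
    (s := Icc 0 R ×ˢ Icc 0 l) hc.continuousOn
  have hm : MeasurableSet (Ioo 0 R ×ˢ Ioc 0 l) := measurableSet_Ioo.prod measurableSet_Ioc
  have hs : Ioo 0 R ×ˢ Ioc 0 l ⊆ Icc 0 R ×ˢ Icc 0 l :=
    Set.prod_mono Ioo_subset_Icc_self Ioc_subset_Icc_self
  refine ⟨hc.aestronglyMeasurable.mul (hg.mono_measure (Measure.restrict_mono
    (Set.prod_mono Ioo_subset_Ioi_self (subset_univ _)) le_rfl)),
    HasFiniteIntegral.restrict_of_bounded (C := B * C)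
      ((measure_mono hs).trans_lt (isCompact_Icc.prod isCompact_Icc).measure_lt_top) ?_⟩
  filter_upwards [ae_restrict_mem hm] with p hp
  rw [norm_mul]
  exact mul_le_mul (hB p (hs hp)) (hC p hp.1.1) (norm_nonneg _) ((norm_nonneg _).trans (hB p (hs hp)))

theorem integrableOn_rect_of_continuous {c : ℝ × ℝ → ℝ} (R l : ℝ) (hc : Continuous c) :
    IntegrableOn c (Ioo 0 R ×ˢ Ioc 0 l) :=
  (hc.continuousOn.integrableOn_compact (isCompact_Icc.prod isCompact_Icc)).mono_set
    (Set.prod_mono Ioo_subset_Icc_self Ioc_subset_Icc_self)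

theorem integral_Ioo_eq_sub_of_hasDerivAt_off_countable {f f' : ℝ → ℝ} {S : Set ℝ} {a b : ℝ}
    (hab : a ≤ b) (hS : S.Countable) (hf : Continuous f)
    (hd : ∀ x ∈ Ioo a b, x ∉ S → HasDerivAt f (f' x) x) (hi : IntegrableOn f' (Ioo a b)) :
    ∫ x in Ioo a b, f' x = f b - f a := by
  rw [← integral_Ioc_eq_integral_Ioo, ← intervalIntegral.integral_of_le hab]
  refine integral_eq_of_hasDerivAt_off_countable f f' hS hf.continuousOn (fun x hx => ?_)
    ((intervalIntegrable_iff_integrableOn_Ioo_of_le hab).2 hi)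
  rw [min_eq_left hab, max_eq_right hab] at hx
  exact hd x hx.1 hx.2

section Identities

variable {l R : ℝ} [hl : Fact (0 < l)] {f : Cone l → ℝ} {G : Cone l → EuclideanSpace ℝ (Fin 2)}

/-- The divergence theorem in a ball for the field `a(θ) ∂_r + b(θ) r⁻¹ ∂_θ` with `b' = -a`. -/
theorem HasGradientOffRays.integral_field_eq_zero (h : HasGradientOffRays f G) (hR : 0 < R)
    (h0 : ∀ x, R ≤ radius x → f x = 0) {a b : ℝ → ℝ} (ha : Continuous a) (hb : Continuous b)
    (hbl : b l = b 0) {T : Set ℝ} (hT : T.Countable) (hab : ∀ θ ∉ T, HasDerivAt b (-a θ) θ) :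
    ∫ p in Ioo 0 R ×ˢ Ioc 0 l, p.1 * (a p.2 * G (polar l p) 0 + b p.2 * G (polar l p) 1) = 0 := by
  obtain ⟨C, hC⟩ := h.bounded
  obtain ⟨S, hS, hd⟩ := h.hasDerivAt
  have hC' : ∀ i, ∀ p : ℝ × ℝ, 0 < p.1 → |G (polar l p) i| ≤ C := fun i p hp =>
    (abs_apply_le_norm _ i).trans (hC p hp)
  have ha' : Continuous fun p : ℝ × ℝ => a p.2 := ha.comp continuous_snd
  have hb' : Continuous fun p : ℝ × ℝ => b p.2 := hb.comp continuous_snd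
  have hf' := h.continuous_polar
  have I0 : IntegrableOn (fun p : ℝ × ℝ => a p.2 * f (polar l p)) (Ioo 0 R ×ˢ Ioc 0 l) :=
    integrableOn_rect_of_continuous R l (ha'.mul hf')
  have I1 : IntegrableOn (fun p : ℝ × ℝ => (p.1 * a p.2) * G (polar l p) 0)
      (Ioo 0 R ×ˢ Ioc 0 l) :=
    integrableOn_rect_mul R l (h.measurable_apply 0) (hC' 0) (continuous_fst.mul ha')
  have I2 : IntegrableOn (fun p : ℝ × ℝ => (p.1 * b p.2) * G (polar l p) 1)
      (Ioo 0 R ×ˢ Ioc 0 l) :=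
    integrableOn_rect_mul R l (h.measurable_apply 1) (hC' 1) (continuous_fst.mul hb')
  -- The integrand is $\partial_r(r\,a f)$. The boundary term at $r=R$ vanishes with $f$, the one at
  -- the vertex because of the factor $r$.
  have E1 : ∫ p in Ioo 0 R ×ˢ Ioc 0 l, (a p.2 * f (polar l p) + (p.1 * a p.2) * G (polar l p) 0)
      = 0 := by
    have I := I0.add I1
    rw [IntegrableOn, Measure.volume_eq_prod, ← Measure.prod_restrict] at I
    rw [Measure.volume_eq_prod, ← Measure.prod_restrict]
    refine integral_prod_eq_zero_of_left I ?_
    filter_upwards [ae_restrict_of_ae (hS.ae_notMem volume)] with θ hθ hi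
    rw [integral_Ioo_eq_sub_of_hasDerivAt_off_countable hR.le countable_empty
      (f := fun r => a θ * (r * f (polar l (r, θ))))
      (continuous_const.mul (continuous_id.mul (hf'.comp (Continuous.prodMk_left θ)))) ?_ hi]
    · rw [h0 _ (by rw [radius_polar_of_pos hR])]
      simp
    · intro r hr _
      refine (((hasDerivAt_id r).mul (hd r θ hr.1 hθ).1).const_mul (a θ)).congr_deriv ?_
      simp only [id]
      ring
  -- The integrand is $\partial_\theta(b f)$, by $b'=-a$; the boundary terms at $\theta=0$ and
  -- $\theta=l$ cancel by periodicity. In the sum with `E1` the terms $\pm a f$ cancel.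
  have E2 : ∫ p in Ioo 0 R ×ˢ Ioc 0 l, ((p.1 * b p.2) * G (polar l p) 1 - a p.2 * f (polar l p))
      = 0 := by
    have I := I2.sub I0
    rw [IntegrableOn, Measure.volume_eq_prod, ← Measure.prod_restrict] at I
    rw [Measure.volume_eq_prod, ← Measure.prod_restrict]
    refine integral_prod_eq_zero_of_right I ?_
    filter_upwards [ae_restrict_mem measurableSet_Ioo] with r hr hi
    have hi' : IntegrableOn (fun θ => (r * b θ) * G (polar l (r, θ)) 1 - a θ * f (polar l (r, θ)))
        (Ioo 0 l) := IntegrableOn.mono_set hi Ioo_subset_Ioc_self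
    rw [integral_Ioc_eq_integral_Ioo,
      integral_Ioo_eq_sub_of_hasDerivAt_off_countable hl.out.le (hS.union hT)
      (f := fun θ => b θ * f (polar l (r, θ)))
      (hb.mul (hf'.comp (Continuous.prodMk_right r))) ?_ hi']
    · have := polar_add_int_mul l r 0 1
      rw [Int.cast_one, one_mul, zero_add] at this
      rw [this, hbl, sub_self]
    · intro θ _ hθ
      rw [mem_union, not_or] at hθ
      exact ((hab θ hθ.2).mul (hd r θ hr.1 hθ.1).2).congr_deriv (by ring)
  have E := integral_add (I0.add I1) (I2.sub I0)
  simp only [Pi.add_apply, Pi.sub_apply] at E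
  rw [E1, E2, add_zero] at E
  refine Eq.trans (integral_congr_ae (Eventually.of_forall fun p => ?_)) E
  simp only
  ring

/-- Poincaré's inequality in a ball. -/
theorem HasGradientOffRays.integral_sq_le (h : HasGradientOffRays f G) (hR : 0 < R)
    (h0 : ∀ x, R ≤ radius x → f x = 0) :
    ∫ x in ball l R, f x ^ 2 ∂area l ≤ R ^ 2 * ∫ x in ball l R, ‖G x‖ ^ 2 ∂area l := by
  obtain ⟨C, hC⟩ := h.bounded
  obtain ⟨S, hS, hd⟩ := h.hasDerivAt
  have hf' := h.continuous_polar
  have hn : AEStronglyMeasurable (fun p => ‖G (polar l p)‖ ^ 2)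
      (volume.restrict (Ioi (0 : ℝ) ×ˢ univ)) := h.measurable.norm.pow 2
  rw [integral_ball (f := fun x => f x ^ 2) (h.continuous.pow 2).measurable.aestronglyMeasurable,
    integral_ball (f := fun x => ‖G x‖ ^ 2) (h.aestronglyMeasurable_grad.norm.pow 2)]
  have I0 : IntegrableOn (fun p : ℝ × ℝ => p.1 * f (polar l p) ^ 2) (Ioo 0 R ×ˢ Ioc 0 l) :=
    integrableOn_rect_of_continuous R l (continuous_fst.mul (hf'.pow 2))
  have I1 : IntegrableOn (fun p : ℝ × ℝ => (2 * p.1 ^ 2 * f (polar l p)) * G (polar l p) 0)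
      (Ioo 0 R ×ˢ Ioc 0 l) :=
    integrableOn_rect_mul R l (h.measurable_apply 0)
      (fun p hp => (abs_apply_le_norm _ 0).trans (hC p hp)) ((continuous_const.mul (continuous_fst.pow 2)).mul hf')
  have I2 : IntegrableOn (fun p : ℝ × ℝ => p.1 * ‖G (polar l p)‖ ^ 2) (Ioo 0 R ×ˢ Ioc 0 l) :=
    integrableOn_rect_mul (C := C ^ 2) R l hn
      (fun p hp => by
        rw [abs_of_nonneg (by positivity)]
        exact pow_le_pow_left₀ (norm_nonneg _) (hC p hp) 2) continuous_fst
  -- The integrand is $\partial_r(r^2f^2)$, which vanishes at both ends in integrated form.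
  have E1 : ∫ p in Ioo 0 R ×ˢ Ioc 0 l, (2 * (p.1 * f (polar l p) ^ 2)
      + (2 * p.1 ^ 2 * f (polar l p)) * G (polar l p) 0) = 0 := by
    have I := (I0.const_mul 2).add I1
    rw [Measure.volume_eq_prod, ← Measure.prod_restrict] at I ⊢
    refine integral_prod_eq_zero_of_left I ?_
    filter_upwards [ae_restrict_of_ae (hS.ae_notMem volume)] with θ hθ hi
    rw [integral_Ioo_eq_sub_of_hasDerivAt_off_countable hR.le countable_empty
      (f := fun r => r ^ 2 * f (polar l (r, θ)) ^ 2)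
      ((continuous_pow 2).mul ((hf'.comp (Continuous.prodMk_left θ)).pow 2)) ?_ hi]
    · rw [h0 _ (by rw [radius_polar_of_pos hR])]
      simp
    · intro r hr _
      refine ((hasDerivAt_pow 2 r).mul ((hd r θ hr.1 hθ).1.pow 2)).congr_deriv ?_
      simp
      ring
  rw [integral_add (I0.const_mul 2) I1, integral_const_mul] at E1
  have E2 : -∫ p in Ioo 0 R ×ˢ Ioc 0 l, (2 * p.1 ^ 2 * f (polar l p)) * G (polar l p) 0 ≤
      (∫ p in Ioo 0 R ×ˢ Ioc 0 l, p.1 * f (polar l p) ^ 2)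
      + R ^ 2 * ∫ p in Ioo 0 R ×ˢ Ioc 0 l, p.1 * ‖G (polar l p)‖ ^ 2 := by
    rw [← integral_neg, ← integral_const_mul, ← integral_add I0 (I2.const_mul _)]
    refine setIntegral_mono_on I1.neg (I0.add (I2.const_mul _))
      (measurableSet_Ioo.prod measurableSet_Ioc) fun p hp => ?_
    have hp0 : 0 < p.1 := hp.1.1
    have h1 : (G (polar l p) 0) ^ 2 ≤ ‖G (polar l p)‖ ^ 2 :=
      sq_le_sq.2 (by rw [abs_norm]; exact abs_apply_le_norm _ 0)
    have h2 : p.1 ^ 2 * (G (polar l p) 0) ^ 2 ≤ R ^ 2 * ‖G (polar l p)‖ ^ 2 :=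
      mul_le_mul (pow_le_pow_left₀ hp0.le hp.1.2.le 2) h1 (sq_nonneg _) (sq_nonneg _)
    -- Young's inequality $-2r^2f\,\partial_rf\le r f^2+r^3(\partial_rf)^2$; one of the two copies
    -- of $\int r f^2$ in `E1` survives on the left.
    have h3 := mul_nonneg hp0.le (sq_nonneg (f (polar l p) + p.1 * G (polar l p) 0))
    have h4 := mul_le_mul_of_nonneg_left h2 hp0.le
    simp only
    nlinarith
  linarith

end Identities

/-! ### The calibrating field -/

/-- The function with value `cos t` at angular distance `t ≤ π / 2` from `Lℤ`, and `0` elsewhere. -/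
noncomputable def bump (L θ : ℝ) : ℝ := Real.cos (min ‖(θ : AddCircle L)‖ (Real.pi / 2))

/-- Truncation to `[-π / 2, π / 2]`. -/
noncomputable def clamp (t : ℝ) : ℝ := max (-(Real.pi / 2)) (min (Real.pi / 2) t)

/-- The radial component of the calibrating field. -/
noncomputable def fieldRadial (L θ : ℝ) : ℝ := bump L θ - bump L (θ - L / 2)

/-- The angular component of the calibrating field. -/
noncomputable def fieldAngular (L θ : ℝ) : ℝ :=
  Real.sin (clamp (‖((θ - L / 4 : ℝ) : AddCircle L)‖ - L / 4))

theorem continuous_clamp : Continuous clamp := by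
  unfold clamp
  fun_prop

theorem continuous_bump (L : ℝ) : Continuous (bump L) :=
  Real.continuous_cos.comp (((AddCircle.continuous_mk' L).norm).min continuous_const)

theorem continuous_fieldRadial (L : ℝ) : Continuous (fieldRadial L) :=
  (continuous_bump L).sub ((continuous_bump L).comp (continuous_id.sub continuous_const))

theorem continuous_fieldAngular (L : ℝ) : Continuous (fieldAngular L) :=
  Real.continuous_sin.comp (continuous_clamp.comp
    ((((AddCircle.continuous_mk' L).comp (continuous_id.sub continuous_const)).norm).sub
      continuous_const))

theorem coe_add_int_mul (L θ : ℝ) (n : ℤ) : ((θ + n * L : ℝ) : AddCircle L) = θ :=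
  coe_addCircle_eq_iff.2 ⟨n, rfl⟩

theorem bump_add_int_mul (L θ : ℝ) (n : ℤ) : bump L (θ + n * L) = bump L θ := by
  rw [bump, coe_add_int_mul, bump]

theorem fieldRadial_add_int_mul (L θ : ℝ) (n : ℤ) : fieldRadial L (θ + n * L) = fieldRadial L θ := by
  rw [fieldRadial, bump_add_int_mul, add_sub_right_comm, bump_add_int_mul, fieldRadial]

theorem fieldAngular_add_int_mul (L θ : ℝ) (n : ℤ) :
    fieldAngular L (θ + n * L) = fieldAngular L θ := by
  rw [fieldAngular, add_sub_right_comm, coe_add_int_mul, fieldAngular]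

theorem abs_clamp_le (t : ℝ) : |clamp t| ≤ Real.pi / 2 :=
  abs_le.2 ⟨le_max_left _ _, max_le (by linarith [Real.pi_pos]) (min_le_left _ _)⟩

theorem clamp_of_abs_le {t : ℝ} (h : |t| ≤ Real.pi / 2) : clamp t = t := by
  rw [clamp, min_eq_right (abs_le.1 h).2, max_eq_right (abs_le.1 h).1]

theorem clamp_of_le {t : ℝ} (h : Real.pi / 2 ≤ t) : clamp t = Real.pi / 2 := by
  rw [clamp, min_eq_left h, max_eq_right (by linarith [Real.pi_pos])]

theorem clamp_neg (t : ℝ) : clamp (-t) = -clamp t := by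
  rcases le_total |t| (Real.pi / 2) with h | h
  · rw [clamp_of_abs_le h, clamp_of_abs_le (by rwa [abs_neg])]
  · rcases le_abs.1 h with h | h
    · rw [clamp_of_le h, clamp, max_eq_left ((min_le_right _ _).trans (by linarith))]
    · rw [clamp_of_le h, clamp, max_eq_left ((min_le_right _ _).trans (by linarith)), neg_neg]

theorem cos_min_abs (t : ℝ) : Real.cos (min |t| (Real.pi / 2)) = Real.cos (clamp t) := by
  have h : min |t| (Real.pi / 2) = |clamp t| := by
    rcases le_total |t| (Real.pi / 2) with h | h
    · rw [clamp_of_abs_le h, min_eq_left h]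
    · rw [min_eq_right h]
      have hp : |Real.pi / 2| = Real.pi / 2 := abs_of_pos (by positivity)
      rcases le_abs.1 h with h | h
      · rw [clamp_of_le h, hp]
      · rw [← abs_neg (clamp t), ← clamp_neg, clamp_of_le h, hp]
  rw [h, Real.cos_abs]

theorem cos_clamp_pos_iff (t : ℝ) : 0 < Real.cos (clamp t) ↔ |t| < Real.pi / 2 := by
  rw [← cos_min_abs]
  rcases lt_or_ge |t| (Real.pi / 2) with h | h
  · rw [min_eq_left h.le]
    exact iff_of_true (Real.cos_pos_of_mem_Ioo ⟨by linarith [abs_nonneg t, Real.pi_pos], h⟩) h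
  · rw [min_eq_right h, Real.cos_pi_div_two]
    exact iff_of_false (lt_irrefl _) h.not_gt

theorem hasDerivAt_clamp {t : ℝ} (ht : |t| ≠ Real.pi / 2) :
    HasDerivAt clamp (if |t| < Real.pi / 2 then 1 else 0) t := by
  rcases ht.lt_or_gt with h | h
  · rw [if_pos h]
    refine (hasDerivAt_id t).congr_of_eventuallyEq ?_
    filter_upwards [continuous_abs.continuousAt.eventually_lt_const h] with s hs
    exact clamp_of_abs_le (le_of_lt hs)
  · rw [if_neg h.not_gt]
    rcases lt_abs.1 h with h' | h'
    · refine (hasDerivAt_const t (Real.pi / 2)).congr_of_eventuallyEq ?_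
      filter_upwards [lt_mem_nhds h'] with s hs
      exact clamp_of_le (le_of_lt hs)
    · refine (hasDerivAt_const t (-(Real.pi / 2))).congr_of_eventuallyEq ?_
      have h'' : t < -(Real.pi / 2) := by linarith
      filter_upwards [gt_mem_nhds h''] with s hs
      rw [← neg_neg s, clamp_neg, clamp_of_le (by linarith)]

/-- Where `clamp` is constant its value is $\pm\pi/2$ and the cosine vanishes, so one formula serves
both regimes. This is the source of $b'=-a$. -/
theorem hasDerivAt_sin_clamp {t : ℝ} (ht : |t| ≠ Real.pi / 2) :
    HasDerivAt (fun s => Real.sin (clamp s)) (Real.cos (clamp t)) t := by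
  refine (hasDerivAt_clamp ht).sin.congr_deriv ?_
  split_ifs with h
  · rw [mul_one]
  · rw [mul_zero]
    exact le_antisymm (Real.cos_nonneg_of_mem_Icc (abs_le.1 (abs_clamp_le t)))
      (not_lt.1 fun h' => h ((cos_clamp_pos_iff t).1 h'))

section Field

variable {L : ℝ}

theorem norm_coe_add_int_mul {s : ℝ} (hL : 0 < L) (hs : |s| ≤ L / 2) (n : ℤ) :
    ‖((s + n * L : ℝ) : AddCircle L)‖ = |s| := by
  rw [coe_add_int_mul, AddCircle.norm_coe_eq_abs_iff L hL.ne', abs_of_pos hL]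
  exact hs

theorem bump_eq {s : ℝ} (hL : 0 < L) (hs : |s| ≤ L / 2) (n : ℤ) :
    bump L (s + n * L) = Real.cos (clamp s) := by
  rw [bump, norm_coe_add_int_mul hL hs, cos_min_abs]

theorem bump_nonneg (L θ : ℝ) : 0 ≤ bump L θ :=
  Real.cos_nonneg_of_mem_Icc
    ⟨by linarith [le_min (norm_nonneg (θ : AddCircle L)) (by positivity : 0 ≤ Real.pi / 2),
      Real.pi_pos], min_le_right _ _⟩

theorem bump_eq_zero {θ : ℝ} (h : Real.pi / 2 ≤ ‖(θ : AddCircle L)‖) : bump L θ = 0 := by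
  rw [bump, min_eq_right h, Real.cos_pi_div_two]

theorem bump_pos_iff {θ : ℝ} : 0 < bump L θ ↔ ‖(θ : AddCircle L)‖ < Real.pi / 2 := by
  refine ⟨fun h => not_le.1 fun h' => h.ne' (bump_eq_zero h'), fun h => ?_⟩
  rw [bump, min_eq_left h.le]
  exact Real.cos_pos_of_mem_Ioo ⟨by linarith [norm_nonneg (θ : AddCircle L), Real.pi_pos], h⟩

variable (hL : 2 * Real.pi ≤ L)

include hL

theorem length_pos : 0 < L := by linarith [Real.pi_pos]

theorem bump_even {t : ℝ} (ht : |t| ≤ L / 4) (n : ℤ) : bump L (t + n * L) = Real.cos (clamp t) :=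
  bump_eq (length_pos hL) (by linarith [length_pos hL]) n

/-- Such an angle is at distance at least $L/4\ge\pi/2$ from $L\mathbb Z$; this is where the lower
bound on $L$ enters. -/
theorem bump_odd {t : ℝ} (ht : |t| ≤ L / 4) (n : ℤ) : bump L (L / 2 + t + n * L) = 0 := by
  have h0 := length_pos hL
  obtain ⟨h1, h2⟩ := abs_le.1 ht
  rcases le_total t 0 with h | h
  · refine bump_eq_zero ?_
    rw [norm_coe_add_int_mul h0 (abs_le.2 ⟨by linarith, by linarith⟩), abs_of_nonneg (by linarith)]
    linarith
  · refine bump_eq_zero ?_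
    have e : L / 2 + t + n * L = (t - L / 2) + (n + 1 : ℤ) * L := by push_cast; ring
    rw [e, norm_coe_add_int_mul h0 (abs_le.2 ⟨by linarith, by linarith⟩), abs_of_nonpos (by linarith)]
    linarith

theorem fieldRadial_even {t : ℝ} (ht : |t| ≤ L / 4) (n : ℤ) :
    fieldRadial L (t + n * L) = Real.cos (clamp t) := by
  have e : t + n * L - L / 2 = L / 2 + t + (n - 1 : ℤ) * L := by push_cast; ring
  rw [fieldRadial, bump_even hL ht, e, bump_odd hL ht, sub_zero]

theorem fieldRadial_odd {t : ℝ} (ht : |t| ≤ L / 4) (n : ℤ) :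
    fieldRadial L (L / 2 + t + n * L) = -Real.cos (clamp t) := by
  have e : L / 2 + t + n * L - L / 2 = t + n * L := by ring
  rw [fieldRadial, bump_odd hL ht, e, bump_even hL ht, zero_sub]

/-- The distance to $L/4$ modulo $L$, less $L/4$, is a triangle wave: it equals $-t$ near $L\mathbb
Z$ and $t$ near $L/2+L\mathbb Z$. -/
theorem fieldAngular_even {t : ℝ} (ht : |t| ≤ L / 4) (n : ℤ) :
    fieldAngular L (t + n * L) = -Real.sin (clamp t) := by
  have h0 := length_pos hL
  obtain ⟨h1, h2⟩ := abs_le.1 ht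
  rw [fieldAngular, add_sub_right_comm,
    norm_coe_add_int_mul h0 (abs_le.2 ⟨by linarith, by linarith⟩), abs_of_nonpos (by linarith),
    ← Real.sin_neg, ← clamp_neg]
  congr 2
  ring

theorem fieldAngular_odd {t : ℝ} (ht : |t| ≤ L / 4) (n : ℤ) :
    fieldAngular L (L / 2 + t + n * L) = Real.sin (clamp t) := by
  have h0 := length_pos hL
  obtain ⟨h1, h2⟩ := abs_le.1 ht
  rw [fieldAngular, add_sub_right_comm,
    norm_coe_add_int_mul h0 (abs_le.2 ⟨by linarith, by linarith⟩), abs_of_nonneg (by linarith)]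
  congr 2
  ring

/-- Rounding to the nearest multiple $m$ of $L/2$; the parity of $m$ tells whether $\theta$ lies
around a half-plane of $u$ or around an opposite one. -/
theorem exists_angle_reduction (θ : ℝ) :
    ∃ (m n : ℤ) (t : ℝ), |t| ≤ L / 4 ∧ t = θ - m * (L / 2) ∧
      (θ = t + n * L ∨ θ = L / 2 + t + n * L) := by
  have h0 := length_pos hL
  have h1 := abs_sub_round (θ / (L / 2))
  have h2 : |θ - round (θ / (L / 2)) * (L / 2)| ≤ L / 4 := by
    have e : θ - round (θ / (L / 2)) * (L / 2) = (θ / (L / 2) - round (θ / (L / 2))) * (L / 2) := by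
      field_simp
    rw [e, abs_mul, abs_of_pos (by linarith : 0 < L / 2)]
    nlinarith
  obtain ⟨n, hn⟩ := Int.even_or_odd' (round (θ / (L / 2)))
  refine ⟨_, n, _, h2, rfl, ?_⟩
  rcases hn with hn | hn
  · left
    rw [hn]
    push_cast
    ring
  · right
    rw [hn]
    push_cast
    ring

theorem fieldRadial_sq_add_fieldAngular_sq (θ : ℝ) :
    fieldRadial L θ ^ 2 + fieldAngular L θ ^ 2 = 1 := by
  obtain ⟨m, n, t, ht, -, rfl | rfl⟩ := exists_angle_reduction hL θ
  · rw [fieldRadial_even hL ht, fieldAngular_even hL ht, neg_sq, Real.cos_sq_add_sin_sq]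
  · rw [fieldRadial_odd hL ht, fieldAngular_odd hL ht, neg_sq, Real.cos_sq_add_sin_sq]

theorem fieldRadial_of_bump_pos {θ : ℝ} (h : 0 < bump L θ) : fieldRadial L θ = bump L θ := by
  obtain ⟨m, n, t, ht, -, rfl | rfl⟩ := exists_angle_reduction hL θ
  · rw [fieldRadial_even hL ht, bump_even hL ht]
  · exact absurd (bump_odd hL ht n) h.ne'

theorem exists_countable_hasDerivAt : ∃ T : Set ℝ, T.Countable ∧ ∀ θ ∉ T,
    HasDerivAt (fieldAngular L) (-fieldRadial L θ) θ ∧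
    HasDerivAt (bump L) (if 0 < bump L θ then fieldAngular L θ else 0) θ := by
  -- The excluded angles are the junctions of consecutive intervals of length $L/2$, where the local
  -- formula changes, and the kinks of `clamp`.
  refine ⟨⋃ m : ℤ, {m * (L / 2) + L / 4, m * (L / 2) + -(L / 4), m * (L / 2) + Real.pi / 2,
    m * (L / 2) + -(Real.pi / 2)}, countable_iUnion fun m => (Set.toFinite _).countable,
    fun θ hθ => ?_⟩
  obtain ⟨m, n, t, ht, htm, h⟩ := exists_angle_reduction hL θ
  simp only [mem_iUnion, mem_insert_iff, mem_singleton_iff, not_exists, not_or] at hθ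
  have h0 := length_pos hL
  have hθm : θ = m * (L / 2) + t := by rw [htm]; ring
  have hne : ∀ c : ℝ, 0 < c → θ ≠ m * (L / 2) + c → θ ≠ m * (L / 2) + -c → |t| ≠ c := by
    intro c hc h1 h2 h3
    rcases (abs_eq hc.le).1 h3 with h3 | h3
    · exact h1 (by rw [hθm, h3])
    · exact h2 (by rw [hθm, h3])
  have hlt : |t| < L / 4 := ht.lt_of_ne (hne _ (by linarith) (hθ m).1 (hθ m).2.1)
  have hpi : |t| ≠ Real.pi / 2 := hne _ (by positivity) (hθ m).2.2.1 (hθ m).2.2.2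
  have hsin := hasDerivAt_sin_clamp hpi
  have hcos := (hasDerivAt_clamp hpi).cos
  rcases h with rfl | rfl
  · have hshift : ∀ {F : ℝ → ℝ} {F' : ℝ}, HasDerivAt F F' t →
        HasDerivAt (fun η => F (η - n * L)) F' (t + n * L) := fun {F F'} hF =>
      HasDerivAt.comp_sub_const (t + n * L) (n * L) (by rwa [add_sub_cancel_right])
    have hev : ∀ᶠ η in 𝓝 (t + n * L), |η - n * L| ≤ L / 4 := by
      have hc : Continuous fun η : ℝ => |η - n * L| := by fun_prop
      refine (hc.continuousAt.eventually_lt_const ?_).mono fun η hη => hη.le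
      simpa only [add_sub_cancel_right] using hlt
    rw [fieldRadial_even hL ht, fieldAngular_even hL ht, bump_even hL ht]
    refine ⟨(hshift hsin.neg).congr_of_eventuallyEq ?_, ((hshift hcos).congr_deriv ?_).congr_of_eventuallyEq ?_⟩
    · filter_upwards [hev] with η hη
      conv_lhs => rw [← sub_add_cancel η (n * L)]
      rw [fieldAngular_even hL hη]
      rfl
    · simp only [cos_clamp_pos_iff]
      split_ifs <;> simp
    · filter_upwards [hev] with η hη
      conv_lhs => rw [← sub_add_cancel η (n * L)]
      rw [bump_even hL hη]
  · have hshift : ∀ {F : ℝ → ℝ} {F' : ℝ}, HasDerivAt F F' t →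
        HasDerivAt (fun η => F (η - (L / 2 + n * L))) F' (L / 2 + t + n * L) := fun {F F'} hF =>
      HasDerivAt.comp_sub_const _ _ (by
        rwa [show L / 2 + t + n * L - (L / 2 + n * L) = t by ring])
    have hev : ∀ᶠ η in 𝓝 (L / 2 + t + n * L), |η - (L / 2 + n * L)| ≤ L / 4 := by
      have hc : Continuous fun η : ℝ => |η - (L / 2 + n * L)| := by fun_prop
      refine (hc.continuousAt.eventually_lt_const ?_).mono fun η hη => hη.le
      simpa only [show L / 2 + t + n * L - (L / 2 + n * L) = t by ring] using hlt
    have hsplit : ∀ η : ℝ, η = L / 2 + (η - (L / 2 + n * L)) + n * L := fun η => by ring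
    rw [fieldRadial_odd hL ht, fieldAngular_odd hL ht, bump_odd hL ht, neg_neg, if_neg (lt_irrefl _)]
    refine ⟨(hshift hsin).congr_of_eventuallyEq ?_,
      (hasDerivAt_const _ (0 : ℝ)).congr_of_eventuallyEq ?_⟩
    · filter_upwards [hev] with η hη
      conv_lhs => rw [hsplit η]
      rw [fieldAngular_odd hL hη]
    · filter_upwards [hev] with η hη
      conv_lhs => rw [hsplit η]
      rw [bump_odd hL hη]

end Field

/-! ### Unions of half-planes and the calibration on the cone -/

section HalfPlanes

variable {l : ℝ} [Fact (0 < l)]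

/-- On the cone of length `k * L`, the function `r cos (θ - j L)⁺` around each ray `θ = j L`. -/
noncomputable def halfPlanes (L : ℝ) (x : Cone l) : ℝ := (coords x).1 * bump L (coords x).2

/-- The calibrating field on the cone, in the frame `∂_r, r⁻¹ ∂_θ`. -/
noncomputable def field (L : ℝ) (x : Cone l) : EuclideanSpace ℝ (Fin 2) :=
  !₂[fieldRadial L (coords x).2, fieldAngular L (coords x).2]

/-- The indicator function of the positive reals. -/
noncomputable def heaviside (t : ℝ) : ℝ := if 0 < t then 1 else 0

/-- The gradient of `halfPlanes L`. -/
noncomputable def halfPlanesGrad (L : ℝ) (x : Cone l) : EuclideanSpace ℝ (Fin 2) :=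
  heaviside (halfPlanes L x) • field L x

theorem measurable_heaviside : Measurable heaviside :=
  Measurable.ite measurableSet_Ioi measurable_const measurable_const

theorem measurable_field (L : ℝ) : Measurable (field L : Cone l → EuclideanSpace ℝ (Fin 2)) := by
  refine (PiLp.continuous_toLp 2 _).measurable.comp (measurable_pi_iff.2 fun i => ?_)
  fin_cases i
  · exact (continuous_fieldRadial L).measurable.comp measurable_coords.snd
  · exact (continuous_fieldAngular L).measurable.comp measurable_coords.snd

theorem norm_field {L : ℝ} (hL : 2 * Real.pi ≤ L) (x : Cone l) : ‖field L x‖ = 1 := by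
  rw [EuclideanSpace.norm_eq, Real.sqrt_eq_one, Fin.sum_univ_two, Real.norm_eq_abs, Real.norm_eq_abs,
    sq_abs, sq_abs]
  exact fieldRadial_sq_add_fieldAngular_sq hL _

variable {L : ℝ} {k : ℕ} (hl : l = k * L)

include hl

theorem exists_coords_polar_multiple {r : ℝ} (θ : ℝ) (hr : 0 < r) :
    ∃ n : ℤ, coords (polar l (r, θ)) = (r, θ + n * L) := by
  obtain ⟨n, hn⟩ := exists_coords_polar (l := l) θ hr
  refine ⟨n * k, ?_⟩
  rw [hn, hl]
  push_cast
  rw [mul_assoc]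

theorem halfPlanes_polar {r : ℝ} (θ : ℝ) (hr : 0 < r) :
    halfPlanes L (polar l (r, θ)) = r * bump L θ := by
  obtain ⟨n, hn⟩ := exists_coords_polar_multiple hl θ hr
  rw [halfPlanes, hn, bump_add_int_mul]

theorem field_polar {r : ℝ} (θ : ℝ) (hr : 0 < r) :
    field L (polar l (r, θ)) = !₂[fieldRadial L θ, fieldAngular L θ] := by
  obtain ⟨n, hn⟩ := exists_coords_polar_multiple hl θ hr
  rw [field, hn, fieldRadial_add_int_mul, fieldAngular_add_int_mul]

/-- The formula $r\cdot$`bump` is continuous on the covering; the factor $r$ makes it independent of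
the angle at the vertex. -/
theorem continuous_halfPlanes : Continuous (halfPlanes L : Cone l → ℝ) := by
  rw [(isQuotientMap_polar_coe l).continuous_iff]
  have h : halfPlanes L ∘ (fun q : ℝ≥0 × ℝ => polar l (q.1, q.2)) =
      fun q : ℝ≥0 × ℝ => (q.1 : ℝ) * bump L q.2 := by
    funext q
    rcases eq_or_ne q.1 0 with h | h
    · simp [halfPlanes, coords, radius_polar, h]
    · exact halfPlanes_polar hl q.2 (NNReal.coe_pos.2 (pos_iff_ne_zero.2 h))
  rw [h]
  exact (NNReal.continuous_coe.comp continuous_fst).mul ((continuous_bump L).comp continuous_snd)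

theorem halfPlanes_hasGradientOffRays (hL : 2 * Real.pi ≤ L) :
    HasGradientOffRays (halfPlanes L : Cone l → ℝ) (halfPlanesGrad L) where
  continuous := continuous_halfPlanes hl
  measurable := by
    refine AEStronglyMeasurable.restrict ?_
    exact ((measurable_heaviside.comp (continuous_halfPlanes hl).measurable).smul
      (measurable_field L)).aestronglyMeasurable.comp_measurable (measurable_polar l)
  bounded := by
    refine ⟨1, fun p _ => ?_⟩
    rw [halfPlanesGrad, norm_smul, norm_field hL, mul_one, heaviside]
    split_ifs <;> simp
  hasDerivAt := by
    obtain ⟨T, hT, h⟩ := exists_countable_hasDerivAt hL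
    refine ⟨T, hT, fun r θ hr hθ => ?_⟩
    have hpos : 0 < halfPlanes L (polar l (r, θ)) ↔ 0 < bump L θ := by
      rw [halfPlanes_polar hl θ hr, mul_pos_iff_of_pos_left hr]
    have h0 : halfPlanesGrad L (polar l (r, θ)) 0 = bump L θ := by
      rw [halfPlanesGrad, field_polar hl θ hr, heaviside, PiLp.smul_apply]
      split_ifs with hp
      · simpa using fieldRadial_of_bump_pos hL (hpos.1 hp)
      · simpa using le_antisymm (bump_nonneg L θ) (not_lt.1 (hpos.not.1 hp))
    have h1 : halfPlanesGrad L (polar l (r, θ)) 1 =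
        if 0 < bump L θ then fieldAngular L θ else 0 := by
      rw [halfPlanesGrad, field_polar hl θ hr, heaviside, PiLp.smul_apply]
      simp only [hpos]
      split_ifs <;> simp
    rw [h0, h1]
    constructor
    · have hd : HasDerivAt (fun s => s * bump L θ) (bump L θ) r := by
        simpa using (hasDerivAt_id r).mul_const (bump L θ)
      refine hd.congr_of_eventuallyEq ?_
      filter_upwards [lt_mem_nhds hr] with s hs
      exact halfPlanes_polar hl θ hs
    · refine ((h θ hθ).2.const_mul r).congr_of_eventuallyEq (Eventually.of_forall fun η => ?_)
      exact halfPlanes_polar hl η hr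

theorem integral_inner_field_eq_zero (hL : 2 * Real.pi ≤ L) {R : ℝ} (hR : 0 < R) {f : Cone l → ℝ}
    {G : Cone l → EuclideanSpace ℝ (Fin 2)} (h : HasGradientOffRays f G)
    (h0 : ∀ x, R ≤ radius x → f x = 0) :
    ∫ x in ball l R, inner ℝ (field L x) (G x) ∂area l = 0 := by
  obtain ⟨T, hT, hd⟩ := exists_countable_hasDerivAt hL
  -- The field closes up on the cone because $l$ is an integer multiple of its period $L$.
  have hb : fieldAngular L l = fieldAngular L 0 := by
    have := fieldAngular_add_int_mul L 0 k
    rwa [zero_add, Int.cast_natCast, ← hl] at this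
  have key := h.integral_field_eq_zero hR h0 (continuous_fieldRadial L) (continuous_fieldAngular L) hb
    hT fun θ hθ => (hd θ hθ).1
  rw [integral_ball ((measurable_field L).aestronglyMeasurable.inner h.aestronglyMeasurable_grad)]
  refine Eq.trans (setIntegral_congr_fun (measurableSet_Ioo.prod measurableSet_Ioc)
    fun p hp => ?_) key
  simp only
  rw [field_polar hl p.2 hp.1.1]
  simp [PiLp.inner_apply, Fin.sum_univ_two, mul_comm]

end HalfPlanes

/-! ### Passage to the limit -/

theorem abs_mul_inner_le {E : Type*} [NormedAddCommGroup E] [InnerProductSpace ℝ E] {c : ℝ}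
    {X D : E} (hc : |c| ≤ 1) (hX : ‖X‖ ≤ 1) : |c * inner ℝ X D| ≤ ‖D‖ := by
  rw [abs_mul]
  calc |c| * |inner ℝ X D| ≤ 1 * (‖X‖ * ‖D‖) :=
        mul_le_mul hc (abs_real_inner_le_norm X D) (abs_nonneg _) zero_le_one
    _ ≤ ‖D‖ := by
        rw [one_mul]
        exact mul_le_of_le_one_left (norm_nonneg _) hX

/-- The integrands converge in $L^1$: one error is at most $|D-D_n|$, small because the measure is
finite, and the other at most $K|v-v_n||D|$, small by Cauchy–Schwarz. The Lipschitz condition on $g$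
is what makes the second estimate work. -/
theorem tendsto_integral_mul_inner {α E : Type*} [MeasurableSpace α] [NormedAddCommGroup E]
    [InnerProductSpace ℝ E] {ν : Measure α} [IsFiniteMeasure ν] {X D : α → E} {Dn : ℕ → α → E}
    {v : α → ℝ} {vn : ℕ → α → ℝ} {g : ℝ → ℝ} {K : ℝ≥0} (hX : AEStronglyMeasurable X ν)
    (hX1 : ∀ x, ‖X x‖ ≤ 1) (hD : MemLp D 2 ν) (hDn : ∀ n, MemLp (Dn n) 2 ν)
    (hv : AEStronglyMeasurable v ν) (hvn : ∀ n, AEStronglyMeasurable (vn n) ν)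
    (hg : LipschitzWith K g) (hg1 : ∀ t, |g t| ≤ 1)
    (h1 : Tendsto (fun n => eLpNorm (v - vn n) 2 ν) atTop (𝓝 0))
    (h2 : Tendsto (fun n => eLpNorm (D - Dn n) 2 ν) atTop (𝓝 0)) :
    Tendsto (fun n => ∫ x, g (vn n x) * inner ℝ (X x) (Dn n x) ∂ν) atTop
      (𝓝 (∫ x, g (v x) * inner ℝ (X x) (D x) ∂ν)) := by
  refine tendsto_integral_of_L1 _
    ((hg.continuous.comp_aestronglyMeasurable hv).mul (hX.inner hD.1))
    (Eventually.of_forall fun n => ?_) ?_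
  · refine ((hDn n).integrable (by norm_num)).norm.mono'
      ((hg.continuous.comp_aestronglyMeasurable (hvn n)).mul (hX.inner (hDn n).1))
      (Eventually.of_forall fun x => ?_)
    exact abs_mul_inner_le (hg1 _) (hX1 x)
  · have hbound : ∀ n, ∫⁻ x, ‖g (vn n x) * inner ℝ (X x) (Dn n x) -
        g (v x) * inner ℝ (X x) (D x)‖ₑ ∂ν ≤
        eLpNorm (D - Dn n) 2 ν * ν univ ^ (1 / (1 : ℝ≥0∞).toReal - 1 / (2 : ℝ≥0∞).toReal) +
          K * (eLpNorm (v - vn n) 2 ν * eLpNorm D 2 ν) := by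
      intro n
      have hpt : ∀ x, ‖g (vn n x) * inner ℝ (X x) (Dn n x) - g (v x) * inner ℝ (X x) (D x)‖ₑ ≤
          ‖(D - Dn n) x‖ₑ + K * ‖((v - vn n) • D) x‖ₑ := by
        intro x
        have e : g (vn n x) * inner ℝ (X x) (Dn n x) - g (v x) * inner ℝ (X x) (D x) =
            -(g (vn n x) * inner ℝ (X x) (D x - Dn n x)) +
              (g (vn n x) - g (v x)) * inner ℝ (X x) (D x) := by
          rw [inner_sub_right]
          ring
        rw [e]
        refine (enorm_add_le _ _).trans (add_le_add ?_ ?_)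
        · rw [enorm_neg]
          exact enorm_le_iff_norm_le.2 (abs_mul_inner_le (hg1 _) (hX1 x))
        · rw [enorm_mul, Pi.smul_apply', enorm_smul, ← mul_assoc]
          refine mul_le_mul' ?_ (enorm_le_iff_norm_le.2 ?_)
          · rw [← edist_eq_enorm_sub, Pi.sub_apply, ← edist_eq_enorm_sub, edist_comm (v x)]
            exact hg _ _
          · simpa using abs_mul_inner_le (c := 1) (D := D x) (by simp) (hX1 x)
      calc _ ≤ ∫⁻ x, (‖(D - Dn n) x‖ₑ + K * ‖((v - vn n) • D) x‖ₑ) ∂ν := lintegral_mono hpt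
        _ = eLpNorm (D - Dn n) 1 ν + K * eLpNorm ((v - vn n) • D) 1 ν := by
          rw [lintegral_add_left' (hD.1.sub (hDn n).1).enorm,
            lintegral_const_mul' _ _ ENNReal.coe_ne_top, eLpNorm_one_eq_lintegral_enorm,
            eLpNorm_one_eq_lintegral_enorm]
        _ ≤ _ := by
          refine add_le_add (eLpNorm_le_eLpNorm_mul_rpow_measure_univ (by norm_num)
            (hD.1.sub (hDn n).1)) ?_
          gcongr
          exact eLpNorm_smul_le_mul_eLpNorm hD.1 (hv.sub (hvn n))
    refine tendsto_of_tendsto_of_tendsto_of_le_of_le tendsto_const_nhds ?_ (fun _ => zero_le)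
      hbound
    have t1 := ENNReal.Tendsto.mul_const (b := ν univ ^ (1 / (1 : ℝ≥0∞).toReal -
      1 / (2 : ℝ≥0∞).toReal)) h2 (Or.inr (by
        refine ENNReal.rpow_ne_top_of_nonneg (by norm_num) (measure_ne_top ν univ)))
    have t2 := ENNReal.Tendsto.const_mul (a := (K : ℝ≥0∞))
      (ENNReal.Tendsto.mul_const (b := eLpNorm D 2 ν) h1 (Or.inr hD.2.ne)) (Or.inr ENNReal.coe_ne_top)
    simpa using t1.add t2

/-! ### Minimality -/

theorem IsTestFunction.eq_zero {l R : ℝ} {φ : Cone l → ℝ} (h : IsTestFunction (ball l R) φ) (x : Cone l)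
    (hx : R ≤ radius x) : φ x = 0 :=
  image_eq_zero_of_notMem_tsupport fun hm => hx.not_gt (h.support_subset hm)

theorem abs_heaviside_le (t : ℝ) : |heaviside t| ≤ 1 := by
  rw [heaviside]
  split_ifs <;> simp

theorem heaviside_nonneg (t : ℝ) : 0 ≤ heaviside t := by
  rw [heaviside]
  split_ifs <;> simp

theorem aestronglyMeasurable_heaviside {l : ℝ} {v : Cone l → ℝ} {ν : Measure (Cone l)}
    (hv : AEStronglyMeasurable v ν) : AEStronglyMeasurable (fun x => heaviside (v x)) ν :=
  (measurable_heaviside.comp_aemeasurable hv.aemeasurable).aestronglyMeasurable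

/-- The functional `J` as a Bochner integral. -/
noncomputable def energy {l : ℝ} (R : ℝ) (v : Cone l → ℝ) : ℝ :=
  ∫ x in ball l R, (‖weakGrad (ball l R) v x‖ ^ 2 + heaviside (v x)) ∂area l

theorem energy_nonneg {l : ℝ} (R : ℝ) (v : Cone l → ℝ) : 0 ≤ energy R v :=
  integral_nonneg fun _ => add_nonneg (sq_nonneg _) (heaviside_nonneg _)

theorem heaviside_mul_self (t : ℝ) : heaviside t * heaviside t = heaviside t := by
  rw [heaviside]
  split_ifs <;> simp

theorem memLp_heaviside {l R : ℝ} {v : Cone l → ℝ} (hv : MemH1 (ball l R) v) (q : ℝ≥0∞) :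
    MemLp (fun x => heaviside (v x)) q ((area l).restrict (ball l R)) :=
  MemLp.of_bound (aestronglyMeasurable_heaviside hv.1.1) 1
    (Eventually.of_forall fun x => abs_heaviside_le (v x))

section Minimality

variable {l : ℝ} [Fact (0 < l)] {L : ℝ} {k : ℕ} {R : ℝ}

/-- Approximate $v$ by $u+\varphi_n$ with test functions $\varphi_n$. For these, both integrands are
fluxes $X\cdot D F(\cdot)$ with $F'=g$, and $F(u+\varphi_n)-F(u)$ vanishes outside the ball.
Minimality uses it with $u$ the half-plane function, uniqueness with $u=0$. -/
theorem integral_mul_inner_field_eq (hl : l = k * L) (hL : 2 * Real.pi ≤ L) (hR : 0 < R)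
    {u v : Cone l → ℝ} {G : Cone l → EuclideanSpace ℝ (Fin 2)} (hu : HasGradientOffRays u G)
    (hv : MemH1 (ball l R) v) (hvu : MemH10 (ball l R) (v - u)) {g : ℝ → ℝ} {K : ℝ≥0}
    (hg : LipschitzWith K g) (hg1 : ∀ t, |g t| ≤ 1) :
    ∫ x in ball l R, g (v x) * inner ℝ (field L x) (weakGrad (ball l R) v x) ∂area l =
      ∫ x in ball l R, g (u x) * inner ℝ (field L x) (G x) ∂area l := by
  obtain ⟨-, φ, hφ, h1, h2⟩ := hvu
  have hφG := fun n => (hφ n).hasGradientOffRays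
  have hvn := fun n => hu.add (hφG n)
  have hXm : AEStronglyMeasurable (field L) ((area l).restrict (ball l R)) :=
    (measurable_field L).aestronglyMeasurable
  have hD := hv.memLp_weakGrad (isOpen_ball l R)
  have e1 : ∀ n, v - (u + φ n) = v - u - φ n := fun n => (sub_sub v u (φ n)).symm
  have e2 : ∀ n, eLpNorm (weakGrad (ball l R) v - (G + classicalGrad (φ n))) 2
      ((area l).restrict (ball l R)) = eLpNorm (weakGrad (ball l R) (v - u - φ n)) 2
      ((area l).restrict (ball l R)) := by
    intro n
    refine (eLpNorm_congr_ae ?_).symm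
    rw [← e1]
    exact (hv.hasWeakGradient.sub ((hvn n).hasWeakGradient _)).weakGrad_ae_eq (isOpen_ball l R)
  have hlim := tendsto_integral_mul_inner (ν := (area l).restrict (ball l R)) hXm
    (fun x => (norm_field hL x).le) hD (fun n => (hvn n).memLp_grad R 2) hv.1.1
    (fun n => (hvn n).continuous.measurable.aestronglyMeasurable) hg hg1
    (by simpa only [e1] using h1) (by simpa only [e2] using h2)
  refine tendsto_nhds_unique hlim ((tendsto_congr fun n => ?_).2 tendsto_const_nhds)
  have hF : ∀ t, HasDerivAt (fun t => ∫ s in (0 : ℝ)..t, g s) (g t) t := fun t =>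
    (hg.continuous.integral_hasStrictDerivAt 0 t).hasDerivAt
  have c1 := (hvn n).comp hF hg.continuous hg1
  have c2 := hu.comp hF hg.continuous hg1
  have key := integral_inner_field_eq_zero hl hL hR (c1.sub c2) fun x hx => by
    simp [(hφ n).eq_zero x hx]
  have hint : ∀ {f : Cone l → ℝ} {H : Cone l → EuclideanSpace ℝ (Fin 2)},
      HasGradientOffRays f H →
      Integrable (fun x => inner ℝ (field L x) (H x)) ((area l).restrict (ball l R)) := by
    intro f H h
    refine (memLp_one_iff_integrable.1 (h.memLp_grad R 1)).norm.mono'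
      (hXm.inner h.aestronglyMeasurable_grad.restrict) (Eventually.of_forall fun x => ?_)
    simpa using abs_mul_inner_le (c := 1) (D := H x) (by simp) (norm_field hL x).le
  simp only [Pi.sub_apply, inner_sub_right] at key
  rw [integral_sub (hint c1) (hint c2), sub_eq_zero] at key
  simpa only [real_inner_smul_right] using key

/-- The ramps $\min(1,mt)^+$ vanish for $t\le 0$, so the limit has the value $0$ at $0$, as
`heaviside` does. -/
theorem exists_lipschitz_tendsto_heaviside : ∃ g : ℕ → ℝ → ℝ, (∀ m, ∃ K, LipschitzWith K (g m)) ∧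
    (∀ m t, |g m t| ≤ 1) ∧ ∀ t, Tendsto (fun m => g m t) atTop (𝓝 (heaviside t)) := by
  refine ⟨fun m t => max 0 (min 1 ((m : ℝ) * t)), fun m => ?_, fun m t => ?_, fun t => ?_⟩
  · have h : LipschitzWith ‖(m : ℝ)‖₊ fun t : ℝ => (m : ℝ) * t := by
      simpa using! lipschitzWith_smul (m : ℝ) (β := ℝ)
    exact ⟨_, (h.const_min 1).const_max 0⟩
  · rw [abs_of_nonneg (le_max_left _ _)]
    exact max_le zero_le_one (min_le_left _ _)
  · rw [heaviside]
    split_ifs with ht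
    · refine tendsto_const_nhds.congr' ?_
      filter_upwards [tendsto_natCast_atTop_atTop.eventually_ge_atTop (1 / t)] with m hm
      rw [min_eq_left ((div_le_iff₀ ht).1 hm), max_eq_right zero_le_one]
    · refine tendsto_const_nhds.congr fun m => Eq.symm ?_
      have : (m : ℝ) * t ≤ 0 := mul_nonpos_of_nonneg_of_nonpos m.cast_nonneg (not_lt.1 ht)
      exact max_eq_left ((min_le_right _ _).trans this)

theorem tendsto_integral_mul_inner_heaviside {α E : Type*} [MeasurableSpace α]
    [NormedAddCommGroup E] [InnerProductSpace ℝ E] {ν : Measure α} {X D : α → E} {v : α → ℝ}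
    {g : ℕ → ℝ → ℝ} (hX : AEStronglyMeasurable X ν) (hX1 : ∀ x, ‖X x‖ ≤ 1) (hD : Integrable D ν)
    (hv : AEStronglyMeasurable v ν) (hgc : ∀ m, Continuous (g m)) (hg1 : ∀ m t, |g m t| ≤ 1)
    (hg : ∀ t, Tendsto (fun m => g m t) atTop (𝓝 (heaviside t))) :
    Tendsto (fun m => ∫ x, g m (v x) * inner ℝ (X x) (D x) ∂ν) atTop
      (𝓝 (∫ x, heaviside (v x) * inner ℝ (X x) (D x) ∂ν)) :=
  tendsto_integral_of_dominated_convergence (fun x => ‖D x‖)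
    (fun m => ((hgc m).comp_aestronglyMeasurable hv).mul (hX.inner hD.1)) hD.norm
    (fun m => Eventually.of_forall fun x => abs_mul_inner_le (hg1 m _) (hX1 x))
    (Eventually.of_forall fun x => (hg (v x)).mul_const _)

theorem integral_heaviside_mul_inner_field_eq (hl : l = k * L) (hL : 2 * Real.pi ≤ L) (hR : 0 < R)
    {u v : Cone l → ℝ} {G : Cone l → EuclideanSpace ℝ (Fin 2)} (hu : HasGradientOffRays u G)
    (hv : MemH1 (ball l R) v) (hvu : MemH10 (ball l R) (v - u)) :
    ∫ x in ball l R, heaviside (v x) * inner ℝ (field L x) (weakGrad (ball l R) v x) ∂area l =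
      ∫ x in ball l R, heaviside (u x) * inner ℝ (field L x) (G x) ∂area l := by
  obtain ⟨g, hgl, hg1, hg⟩ := exists_lipschitz_tendsto_heaviside
  choose K hK using hgl
  have hXm : AEStronglyMeasurable (field L) ((area l).restrict (ball l R)) :=
    (measurable_field L).aestronglyMeasurable
  have t1 := tendsto_integral_mul_inner_heaviside hXm (fun x => (norm_field hL x).le)
    ((hv.memLp_weakGrad (isOpen_ball l R)).integrable (by norm_num)) hv.1.1
    (fun m => (hK m).continuous) hg1 hg
  have t2 := tendsto_integral_mul_inner_heaviside hXm (fun x => (norm_field hL x).le)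
    (memLp_one_iff_integrable.1 (hu.memLp_grad R 1))
    hu.continuous.measurable.aestronglyMeasurable (fun m => (hK m).continuous) hg1 hg
  refine tendsto_nhds_unique (t1.congr fun m => ?_) t2
  exact integral_mul_inner_field_eq hl hL hR hu hv hvu (hK m) (hg1 m)

theorem memLp_heaviside_smul_field (hL : 2 * Real.pi ≤ L) {v : Cone l → ℝ}
    (hv : MemH1 (ball l R) v) :
    MemLp (fun x => heaviside (v x) • field L x) 2 ((area l).restrict (ball l R)) := by
  refine MemLp.of_bound ((aestronglyMeasurable_heaviside hv.1.1).smul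
    (measurable_field L).aestronglyMeasurable) 1 (Eventually.of_forall fun x => ?_)
  rw [norm_smul, norm_field hL, mul_one]
  exact abs_heaviside_le (v x)

theorem integrable_energy {v : Cone l → ℝ} (hv : MemH1 (ball l R) v) :
    Integrable (fun x => ‖weakGrad (ball l R) v x‖ ^ 2 + heaviside (v x))
      ((area l).restrict (ball l R)) :=
  ((hv.memLp_weakGrad (isOpen_ball l R)).norm.integrable_sq).add
    (memLp_one_iff_integrable.1 (memLp_heaviside hv 1))

theorem J_eq_ofReal_energy {v : Cone l → ℝ} (hv : MemH1 (ball l R) v) :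
    J (ball l R) 1 0 v = ENNReal.ofReal (energy R v) := by
  rw [energy, ofReal_integral_eq_lintegral_ofReal (integrable_energy hv)
    (Eventually.of_forall fun x => add_nonneg (sq_nonneg _) (heaviside_nonneg _)), J]
  refine lintegral_congr fun x => ?_
  rw [ENNReal.ofReal_add (sq_nonneg _) (heaviside_nonneg _), ENNReal.ofReal_pow (norm_nonneg _),
    ofReal_norm]
  by_cases h : 0 < v x <;> simp [heaviside, indicator, h]

/-- The energy exceeds twice the flux of the calibrating field by a square. -/
theorem energy_eq (hL : 2 * Real.pi ≤ L) {v : Cone l → ℝ} (hv : MemH1 (ball l R) v) :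
    energy R v =
      (∫ x in ball l R, ‖weakGrad (ball l R) v x - heaviside (v x) • field L x‖ ^ 2 ∂area l) +
      2 * ∫ x in ball l R, heaviside (v x) * inner ℝ (field L x) (weakGrad (ball l R) v x)
        ∂area l := by
  have hD := hv.memLp_weakGrad (isOpen_ball l R)
  have I1 : Integrable (fun x => ‖weakGrad (ball l R) v x - heaviside (v x) • field L x‖ ^ 2)
      ((area l).restrict (ball l R)) :=
    (hD.sub (memLp_heaviside_smul_field hL hv)).norm.integrable_sq
  have I2 : Integrable (fun x => heaviside (v x) * inner ℝ (field L x) (weakGrad (ball l R) v x))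
      ((area l).restrict (ball l R)) :=
    (hD.integrable (by norm_num)).norm.mono' ((aestronglyMeasurable_heaviside hv.1.1).mul
      ((measurable_field L).aestronglyMeasurable.inner hD.1))
      (Eventually.of_forall fun x => abs_mul_inner_le (abs_heaviside_le _) (norm_field hL x).le)
  rw [← integral_const_mul, ← integral_add I1 (I2.const_mul 2), energy]
  refine integral_congr_ae (Eventually.of_forall fun x => ?_)
  simp only
  rw [norm_sub_sq_real, norm_smul, norm_field hL, mul_one, real_inner_smul_right,
    real_inner_comm, Real.norm_eq_abs, sq_abs, sq, sq, heaviside_mul_self]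
  ring

/-- A function of `H¹₀` whose gradient vanishes is zero. -/
theorem ae_eq_zero_of_weakGrad_ae_eq_zero (hR : 0 < R) {w : Cone l → ℝ}
    (hw : MemH10 (ball l R) w)
    (h : weakGrad (ball l R) w =ᵐ[(area l).restrict (ball l R)] 0) :
    w =ᵐ[(area l).restrict (ball l R)] 0 := by
  obtain ⟨hw1, φ, hφ, h1, h2⟩ := hw
  have hφG := fun n => (hφ n).hasGradientOffRays
  have e2 : ∀ n, eLpNorm (weakGrad (ball l R) (w - φ n)) 2 ((area l).restrict (ball l R)) =
      eLpNorm (classicalGrad (φ n)) 2 ((area l).restrict (ball l R)) := by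
    intro n
    -- As $Dw=0$, $D(w-\varphi_n)=-D\varphi_n$; so $D\varphi_n\to 0$ in $L^2$, and Poincaré's
    -- inequality for $\varphi_n$ gives $\varphi_n\to 0$.
    rw [← eLpNorm_neg (f := classicalGrad (φ n))]
    refine eLpNorm_congr_ae (((hw1.hasWeakGradient.sub
      ((hφG n).hasWeakGradient _)).weakGrad_ae_eq (isOpen_ball l R)).trans ?_)
    filter_upwards [h] with x hx
    simp [hx]
  have hp : ∀ n, eLpNorm (φ n) 2 ((area l).restrict (ball l R)) ≤
      ENNReal.ofReal R * eLpNorm (classicalGrad (φ n)) 2 ((area l).restrict (ball l R)) := by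
    intro n
    rw [(memLp_ball_of_continuous (hφG n).continuous R 2).eLpNorm_eq_integral_rpow_norm
      (by norm_num) (by norm_num), ((hφG n).memLp_grad R 2).eLpNorm_eq_integral_rpow_norm
      (by norm_num) (by norm_num), ← ENNReal.ofReal_mul hR.le]
    refine ENNReal.ofReal_le_ofReal ?_
    have := (hφG n).integral_sq_le hR (hφ n).eq_zero
    simp only [ENNReal.toReal_ofNat, Real.rpow_ofNat, Real.norm_eq_abs, sq_abs, ← one_div,
      ← Real.sqrt_eq_rpow]
    rw [← Real.sqrt_sq hR.le, ← Real.sqrt_mul (sq_nonneg R), Real.sqrt_sq hR.le]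
    exact Real.sqrt_le_sqrt this
  have hbound : ∀ n, eLpNorm w 2 ((area l).restrict (ball l R)) ≤
      eLpNorm (w - φ n) 2 ((area l).restrict (ball l R)) + ENNReal.ofReal R *
        eLpNorm (weakGrad (ball l R) (w - φ n)) 2 ((area l).restrict (ball l R)) := by
    intro n
    have hm := (memLp_ball_of_continuous (hφG n).continuous R 2).1
    calc eLpNorm w 2 ((area l).restrict (ball l R))
        = eLpNorm ((w - φ n) + φ n) 2 ((area l).restrict (ball l R)) := by rw [sub_add_cancel]
      _ ≤ _ := (eLpNorm_add_le (hw1.1.1.sub hm) hm (by norm_num)).trans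
          (add_le_add_right ((hp n).trans_eq (by rw [e2])) _)
  have hlim := h1.add (ENNReal.Tendsto.const_mul (a := ENNReal.ofReal R) h2
    (Or.inr ENNReal.ofReal_ne_top))
  rw [mul_zero, add_zero] at hlim
  have h0 : eLpNorm w 2 ((area l).restrict (ball l R)) = 0 :=
    le_antisymm (ge_of_tendsto' hlim hbound) zero_le
  exact (eLpNorm_eq_zero_iff hw1.1.1 (by norm_num)).1 h0

theorem weakGrad_halfPlanes (hl : l = k * L) (hL : 2 * Real.pi ≤ L) :
    weakGrad (ball l R) (halfPlanes L) =ᵐ[(area l).restrict (ball l R)] halfPlanesGrad L :=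
  ((halfPlanes_hasGradientOffRays hl hL).hasWeakGradient _).weakGrad_ae_eq (isOpen_ball l R)

theorem energy_eq_add (hl : l = k * L) (hL : 2 * Real.pi ≤ L) (hR : 0 < R) {v : Cone l → ℝ}
    (hv : MemH1 (ball l R) v) (hvu : MemH10 (ball l R) (v - halfPlanes L)) :
    energy R v = energy R (halfPlanes L : Cone l → ℝ) +
      ∫ x in ball l R, ‖weakGrad (ball l R) v x - heaviside (v x) • field L x‖ ^ 2 ∂area l := by
  have hu := halfPlanes_hasGradientOffRays hl hL
  rw [energy_eq hL hv, energy_eq hL (hu.memH1 R),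
    integral_heaviside_mul_inner_field_eq hl hL hR hu hv hvu]
  have e1 : ∫ x in ball l R, ‖weakGrad (ball l R) (halfPlanes L) x -
      heaviside (halfPlanes L x) • field L x‖ ^ 2 ∂area l = 0 := by
    refine integral_eq_zero_of_ae ?_
    filter_upwards [weakGrad_halfPlanes (R := R) hl hL] with x hx
    simp [hx, halfPlanesGrad]
  have e2 : ∫ x in ball l R, heaviside (halfPlanes L x) *
      inner ℝ (field L x) (weakGrad (ball l R) (halfPlanes L) x) ∂area l =
      ∫ x in ball l R, heaviside (halfPlanes L x) * inner ℝ (field L x) (halfPlanesGrad L x)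
        ∂area l := by
    refine integral_congr_ae ?_
    filter_upwards [weakGrad_halfPlanes (R := R) hl hL] with x hx
    rw [hx]
  rw [e1, e2]
  ring

theorem isMinimizer_halfPlanes (hl : l = k * L) (hL : 2 * Real.pi ≤ L) (hR : 0 < R) :
    IsMinimizer (ball l R) 1 0 (halfPlanes L) := by
  have hu := (halfPlanes_hasGradientOffRays hl hL).memH1 R
  refine ⟨hu, ?_, fun v hv hvu => ?_⟩
  · rw [J_eq_ofReal_energy hu]
    exact ENNReal.ofReal_lt_top
  · rw [J_eq_ofReal_energy hu, J_eq_ofReal_energy hv, energy_eq_add hl hL hR hv hvu]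
    exact ENNReal.ofReal_le_ofReal (le_add_of_nonneg_right (integral_nonneg fun _ => sq_nonneg _))

/-- Truncation to `[-1, 1]` has the sign of its argument. -/
theorem clip_mul_heaviside_sub {s t : ℝ} :
    0 ≤ max (-1) (min 1 (t - s)) * (heaviside t - heaviside s) ∧
    (max (-1) (min 1 (t - s)) * (heaviside t - heaviside s) = 0 → heaviside t = heaviside s) := by
  simp only [heaviside]
  split_ifs with ht hs hs
  · simp
  · have : 0 < max (-1) (min 1 (t - s)) := lt_max_of_lt_right (lt_min one_pos (by linarith))
    refine ⟨by linarith, fun h => ?_⟩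
    linarith
  · have : max (-1) (min 1 (t - s)) < 0 :=
      max_lt (by norm_num) ((min_le_right _ _).trans_lt (by linarith))
    refine ⟨by linarith, fun h => ?_⟩
    linarith
  · simp

theorem ae_eq_halfPlanes (hl : l = k * L) (hL : 2 * Real.pi ≤ L) (hR : 0 < R) {v : Cone l → ℝ}
    (hv : MemH1 (ball l R) v) (hvu : MemH10 (ball l R) (v - halfPlanes L))
    (hJ : J (ball l R) 1 0 v ≤ J (ball l R) 1 0 (halfPlanes L)) :
    v =ᵐ[(area l).restrict (ball l R)] halfPlanes L := by
  have huG := halfPlanes_hasGradientOffRays hl hL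
  have hu := huG.memH1 R
  have hD := hv.memLp_weakGrad (isOpen_ball l R)
  rw [J_eq_ofReal_energy hu, J_eq_ofReal_energy hv,
    ENNReal.ofReal_le_ofReal_iff (energy_nonneg R _), energy_eq_add hl hL hR hv hvu] at hJ
  have I1 : Integrable (fun x => ‖weakGrad (ball l R) v x - heaviside (v x) • field L x‖ ^ 2)
      ((area l).restrict (ball l R)) :=
    (hD.sub (memLp_heaviside_smul_field hL hv)).norm.integrable_sq
  have hgrad : ∀ᵐ x ∂(area l).restrict (ball l R),
      weakGrad (ball l R) v x = heaviside (v x) • field L x := by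
    have h0 := (integral_eq_zero_iff_of_nonneg (fun _ => sq_nonneg _) I1).1
      (le_antisymm (by simpa using hJ) (integral_nonneg fun _ => sq_nonneg _))
    filter_upwards [h0] with x hx
    simpa [sub_eq_zero] using hx
  have hwgrad : ∀ᵐ x ∂(area l).restrict (ball l R), weakGrad (ball l R) (v - halfPlanes L) x =
      (heaviside (v x) - heaviside (halfPlanes L x)) • field L x := by
    filter_upwards [hgrad, (hv.hasWeakGradient.sub (huG.hasWeakGradient _)).weakGrad_ae_eq
      (isOpen_ball l R)] with x h1 h2
    rw [h2, Pi.sub_apply, h1, halfPlanesGrad, sub_smul]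
  have hlip : LipschitzWith 1 fun t : ℝ => max (-1) (min 1 t) :=
    (LipschitzWith.id.const_min 1).const_max (-1)
  -- The flux identity is applied to $v-u$, compared with the zero function, the truncation to
  -- $[-1,1]$ playing the part of $g$.
  have key := integral_mul_inner_field_eq hl hL hR HasGradientOffRays.zero hvu.1
    (by rwa [sub_zero]) hlip fun t => abs_le.2
      ⟨le_max_left _ _, max_le (by norm_num) (min_le_left _ _)⟩
  simp only [Pi.zero_apply, inner_zero_right, mul_zero, integral_zero] at key
  have e : ∀ᵐ x ∂(area l).restrict (ball l R), max (-1) (min 1 ((v - halfPlanes L : Cone l → ℝ) x)) *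
      inner ℝ (field L x) (weakGrad (ball l R) (v - halfPlanes L) x) =
      max (-1) (min 1 (v x - halfPlanes L x)) *
        (heaviside (v x) - heaviside (halfPlanes L x)) := by
    filter_upwards [hwgrad] with x hx
    rw [hx, real_inner_smul_right, real_inner_self_eq_norm_sq, norm_field hL, one_pow, mul_one,
      Pi.sub_apply]
  rw [integral_congr_ae e, integral_eq_zero_iff_of_nonneg fun x => clip_mul_heaviside_sub.1] at key
  · have hzero : weakGrad (ball l R) (v - halfPlanes L) =ᵐ[(area l).restrict (ball l R)] 0 := by
      filter_upwards [hwgrad, key] with x h1 h2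
      rw [h1, clip_mul_heaviside_sub.2 h2, sub_self, zero_smul, Pi.zero_apply]
    filter_upwards [ae_eq_zero_of_weakGrad_ae_eq_zero hR hvu hzero] with x hx
    exact sub_eq_zero.1 hx
  · refine Integrable.congr ?_ e
    have hw := hvu.1.memLp_weakGrad (isOpen_ball l R)
    refine (hw.integrable (by norm_num)).norm.mono' ((hlip.continuous.comp_aestronglyMeasurable
      hvu.1.1.1).mul ((measurable_field L).aestronglyMeasurable.inner hw.1))
      (Eventually.of_forall fun x => abs_mul_inner_le ?_ (norm_field hL x).le)
    exact abs_le.2 ⟨le_max_left _ _, max_le (by norm_num) (min_le_left _ _)⟩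

end Minimality

/-! ### Positive phases -/

/-- The half-disk of radius `R` around the ray `θ = α`. -/
def halfDisk (l R α : ℝ) : Set (Cone l) :=
  polar l '' (Ioo 0 R ×ˢ Ioo (α - Real.pi / 2) (α + Real.pi / 2))

theorem isPreconnected_halfDisk (l R α : ℝ) : IsPreconnected (halfDisk l R α) :=
  (isPreconnected_Ioo.prod isPreconnected_Ioo).image _ (continuous_polar l).continuousOn

/-- Off the vertex the angle is continuous, and the projection of an open interval to the circle is
open. -/
theorem isOpen_halfDisk (l R α : ℝ) : IsOpen (halfDisk l R α) := by
  have h : halfDisk l R α = {x : Cone l | 0 < radius x ∧ angle x ∈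
      ((↑) : ℝ → AddCircle l) '' Ioo (α - Real.pi / 2) (α + Real.pi / 2)} ∩ ball l R := by
    ext x
    constructor
    · rintro ⟨⟨r, θ⟩, ⟨hr, hθ⟩, rfl⟩
      refine ⟨⟨?_, θ, hθ, (angle_polar θ hr.1).symm⟩, (mem_ball_polar hr.1).2 hr.2⟩
      rw [radius_polar_of_pos hr.1]
      exact hr.1
    · rintro ⟨⟨h0, η, hη, he⟩, hR⟩
      obtain ⟨⟨r, θ⟩, rfl⟩ := polar_surjective l x
      have hr : 0 < r := by
        rw [radius_polar] at h0
        simpa using h0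
      rw [angle_polar θ hr] at he
      obtain ⟨n, rfl⟩ := coe_addCircle_eq_iff.1 he
      exact ⟨(r, θ + n * l), ⟨⟨hr, (mem_ball_polar (p := (r, θ)) hr).1 hR⟩, hη⟩, polar_add_int_mul l r θ n⟩
  rw [h]
  exact (isOpen_setOf_angle_mem (QuotientAddGroup.isOpenMap_coe _ isOpen_Ioo)).inter
    (isOpen_ball l R)

theorem vertex_mem_closure_halfDisk {l R : ℝ} (hR : 0 < R) (α : ℝ) :
    vertex l ∈ closure (halfDisk l R α) := by
  have h : Tendsto (fun r => polar l (r, α)) (𝓝[>] 0) (𝓝 (vertex l)) := by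
    rw [← polar_of_nonpos α (le_refl (0 : ℝ))]
    exact ((continuous_polar l).comp (Continuous.prodMk_left α)).continuousAt.tendsto.mono_left
      nhdsWithin_le_nhds
  refine mem_closure_of_tendsto h ?_
  filter_upwards [Ioo_mem_nhdsGT hR] with r hr
  exact ⟨(r, α), ⟨hr, by constructor <;> linarith [Real.pi_pos]⟩, rfl⟩

theorem halfDisk_nonempty {l R : ℝ} (hR : 0 < R) (α : ℝ) : (halfDisk l R α).Nonempty :=
  closure_nonempty_iff.1 ⟨_, vertex_mem_closure_halfDisk hR α⟩

theorem cos_clamp_eq_max {t : ℝ} (ht : |t| < Real.pi) : Real.cos (clamp t) = max (Real.cos t) 0 := by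
  rcases le_total |t| (Real.pi / 2) with h | h
  · rw [clamp_of_abs_le h, max_eq_left (Real.cos_nonneg_of_mem_Icc (abs_le.1 h))]
  · rw [← cos_min_abs, min_eq_right h, Real.cos_pi_div_two, ← Real.cos_abs t, max_eq_right]
    exact Real.cos_nonpos_of_pi_div_two_le_of_le h (by linarith [Real.pi_pos])

theorem pairwise_disjoint_halfDisk {l L R : ℝ} {k : ℕ} (hl : l = k * L) (hL : 2 * Real.pi ≤ L) :
    Pairwise fun i j : Fin k => Disjoint (halfDisk l R (i * L)) (halfDisk l R (j * L)) := by
  intro i j hij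
  rw [Set.disjoint_left]
  rintro _ ⟨⟨r, θ⟩, ⟨hr, hθ⟩, rfl⟩ ⟨⟨s, η⟩, ⟨hs, hη⟩, he⟩
  obtain ⟨-, n, hn⟩ := (polar_eq_polar_iff hs.1 hr.1).1 he
  simp only [mem_Ioo] at hθ hη
  have h0 := length_pos hL
  -- A common point would put the two central rays, lifted to the covering, at distance less than
  -- $\pi$; that distance is an integer multiple of $L\ge 2\pi$.
  have hd : |((i : ℤ) - (j : ℤ) - n * k : ℤ)| < (1 : ℝ) := by
    have h1 : ((i : ℝ) - j - n * k) * L = (θ - j * L - n * (k * L)) - (θ - i * L) := by ring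
    rw [← hl] at h1
    have h2 : |((i : ℝ) - j - n * k) * L| < Real.pi := by
      rw [h1, abs_lt]
      constructor <;> linarith
    rw [abs_mul, abs_of_pos h0] at h2
    have h3 : |(i : ℝ) - j - n * k| < 1 := by
      by_contra! h
      nlinarith [Real.pi_pos]
    push_cast
    exact h3
  have hz : (i : ℤ) - (j : ℤ) - n * k = 0 := by
    rw [← Int.abs_lt_one_iff]
    exact_mod_cast hd
  have hdvd : (k : ℤ) ∣ (i : ℤ) - (j : ℤ) := ⟨n, by linarith⟩
  have hi := i.2
  have hj := j.2
  have habs : |(i : ℤ) - (j : ℤ)| < k := by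
    rw [abs_lt]
    constructor <;> omega
  have := Int.eq_zero_of_abs_lt_dvd hdvd habs
  exact hij (Fin.ext (by omega))

section Phases

variable {l : ℝ} [Fact (0 < l)] {L : ℝ} {k : ℕ} {R : ℝ}

theorem halfPlanes_nonneg (L : ℝ) (x : Cone l) : 0 ≤ halfPlanes L x :=
  mul_nonneg (radius_nonneg x) (bump_nonneg L _)

theorem halfPlanes_polar_eq_max (hl : l = k * L) (hL : 2 * Real.pi ≤ L) (j : ℕ) {r θ : ℝ}
    (hr : 0 < r) (hθ : |θ - j * L| < Real.pi) :
    halfPlanes L (polar l (r, θ)) = max (r * Real.cos (θ - j * L)) 0 := by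
  have h := bump_eq (length_pos hL) (s := θ - j * L) (by linarith) j
  rw [Int.cast_natCast, sub_add_cancel] at h
  rw [halfPlanes_polar hl θ hr, h, cos_clamp_eq_max hθ, mul_max_of_nonneg _ _ hr.le, mul_zero]

theorem exists_of_halfPlanes_pos (hl : l = k * L) (hk : 1 ≤ k) {x : Cone l}
    (hx : 0 < halfPlanes L x) : ∃ (j : Fin k) (θ : ℝ), 0 < radius x ∧
      |θ - j * L| < Real.pi / 2 ∧ x = polar l (radius x, θ) := by
  have hr : 0 < radius x := by
    refine (radius_nonneg x).lt_of_ne' fun h => hx.ne' ?_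
    rw [halfPlanes, coords, h, zero_mul]
  have hb : 0 < bump L (coords x).2 := (mul_pos_iff_of_pos_left hr).1 hx
  rw [bump_pos_iff, AddCircle.norm_eq] at hb
  -- The nearest ray is $\theta=nL$. Writing $n=k\lfloor n/k\rfloor+(n\bmod k)$ and subtracting
  -- $\lfloor n/k\rfloor\,l$ from the angle brings the index into $\{0,\dots,k-1\}$.
  set n := round (L⁻¹ * (coords x).2)
  have hk0 : (0 : ℤ) < k := by exact_mod_cast hk
  have hm0 := Int.emod_nonneg n hk0.ne'
  have hm1 := Int.emod_lt_of_pos n hk0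
  have hj : (n % k).toNat < k := by omega
  have hcast : (((n % k).toNat : ℕ) : ℝ) = (n : ℝ) - k * (n / k : ℤ) := by
    have h1 : (((n % k).toNat : ℕ) : ℤ) = n - k * (n / k) := by
      rw [Int.toNat_of_nonneg hm0, Int.emod_def]
    exact_mod_cast congrArg (Int.cast : ℤ → ℝ) h1
  refine ⟨⟨_, hj⟩, (coords x).2 + (-(n / k) : ℤ) * l, hr, ?_, ?_⟩
  · rw [show (coords x).2 + (-(n / k) : ℤ) * l - ((n % k).toNat : ℕ) * L = (coords x).2 - n * L by
      rw [hcast]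
      push_cast
      linear_combination (-((n / k : ℤ) : ℝ)) * hl]
    exact hb
  · rw [polar_add_int_mul]
    exact (polar_coords x).symm

theorem setOf_halfPlanes_pos (hl : l = k * L) (hL : 2 * Real.pi ≤ L) (hk : 1 ≤ k) :
    {y ∈ ball l R | 0 < halfPlanes L y} = ⋃ j : Fin k, halfDisk l R (j * L) := by
  ext x
  rw [mem_iUnion]
  constructor
  · rintro ⟨hxR, hx⟩
    obtain ⟨j, θ, hr, hθ, he⟩ := exists_of_halfPlanes_pos hl hk hx
    obtain ⟨h1, h2⟩ := abs_lt.1 hθ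
    exact ⟨j, (radius x, θ), ⟨⟨hr, hxR⟩, by constructor <;> linarith⟩, he.symm⟩
  · rintro ⟨j, ⟨r, θ⟩, ⟨hr, hθ⟩, rfl⟩
    have hθ' : |θ - j * L| < Real.pi / 2 := abs_lt.2 ⟨by linarith [hθ.1], by linarith [hθ.2]⟩
    refine ⟨(mem_ball_polar hr.1).2 hr.2, ?_⟩
    rw [halfPlanes_polar_eq_max hl hL j hr.1 (by linarith [Real.pi_pos])]
    exact lt_max_of_lt_left (mul_pos hr.1 (Real.cos_pos_of_mem_Ioo (abs_lt.1 hθ')))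

theorem positivePhases_halfPlanes (hl : l = k * L) (hL : 2 * Real.pi ≤ L) (hk : 1 ≤ k) (hR : 0 < R) :
    positivePhases (ball l R) (halfPlanes L) = (fun j : Fin k => halfDisk l R (j * L)) '' univ := by
  have hcomp : ∀ j : Fin k, ∀ x ∈ halfDisk l R (j * L),
      connectedComponentIn {y ∈ ball l R | 0 < halfPlanes L y} x = halfDisk l R (j * L) := by
    intro j x hx
    have hsub : halfDisk l R (j * L) ⊆ {y ∈ ball l R | 0 < halfPlanes L y} := by
      rw [setOf_halfPlanes_pos hl hL hk]
      exact subset_iUnion (fun j : Fin k => halfDisk l R (j * L)) j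
    refine Subset.antisymm ?_ ((isPreconnected_halfDisk l R _).subset_connectedComponentIn hx hsub)
    -- The component is covered by two disjoint open sets, this half-disk and the union of the
    -- others, and it meets the first.
    refine IsPreconnected.subset_left_of_subset_union (isOpen_halfDisk l R _)
      (isOpen_iUnion fun i => isOpen_iUnion fun _ : i ≠ j => isOpen_halfDisk l R (i * L)) ?_ ?_
      ⟨x, mem_connectedComponentIn (hsub hx), hx⟩ isPreconnected_connectedComponentIn
    · rw [disjoint_iUnion₂_right]
      exact fun i hi => pairwise_disjoint_halfDisk hl hL hi.symm
    · refine (connectedComponentIn_subset _ _).trans ?_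
      rw [setOf_halfPlanes_pos hl hL hk]
      refine iUnion_subset fun i => ?_
      by_cases hi : i = j
      · rw [hi]
        exact subset_union_left
      · exact subset_union_of_subset_right
          (subset_iUnion₂ (s := fun i (_ : i ≠ j) => halfDisk l R (i * L)) i hi) _
  rw [image_univ]
  ext A
  constructor
  · rintro ⟨x, hx, rfl⟩
    rw [setOf_halfPlanes_pos hl hL hk, mem_iUnion] at hx
    obtain ⟨j, hj⟩ := hx
    exact ⟨j, (hcomp j x hj).symm⟩
  · rintro ⟨j, rfl⟩
    obtain ⟨x, hx⟩ := halfDisk_nonempty (l := l) hR (j * L)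
    refine ⟨x, ?_, (hcomp j x hx).symm⟩
    rw [setOf_halfPlanes_pos hl hL hk]
    exact mem_iUnion_of_mem j hx

theorem ncard_positivePhases_halfPlanes (hl : l = k * L) (hL : 2 * Real.pi ≤ L) (hk : 1 ≤ k)
    (hR : 0 < R) : (positivePhases (ball l R) (halfPlanes L)).ncard = k := by
  rw [positivePhases_halfPlanes hl hL hk hR, ncard_image_of_injective, ncard_univ, Nat.card_fin]
  intro i j hij
  by_contra h
  have hd : Disjoint (halfDisk l R (i * L)) (halfDisk l R (j * L)) :=
    pairwise_disjoint_halfDisk hl hL h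
  have hij' : halfDisk l R (i * L) = halfDisk l R (j * L) := hij
  rw [hij', disjoint_self] at hd
  exact (halfDisk_nonempty hR _).ne_empty hd

theorem vertex_mem_closure_of_mem_positivePhases (hl : l = k * L) (hL : 2 * Real.pi ≤ L)
    (hk : 1 ≤ k) (hR : 0 < R) {A : Set (Cone l)}
    (hA : A ∈ positivePhases (ball l R) (halfPlanes L)) : vertex l ∈ closure A := by
  rw [positivePhases_halfPlanes hl hL hk hR] at hA
  obtain ⟨j, -, rfl⟩ := hA
  exact vertex_mem_closure_halfDisk hR _

theorem halfPlanes_eq_zero (hl : l = k * L) (hk : 1 ≤ k) {x : Cone l}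
    (hx : ∀ j : Fin k, x ∉ sector l (j * L)) : halfPlanes L x = 0 := by
  by_contra h
  obtain ⟨j, θ, hr, hθ, he⟩ :=
    exists_of_halfPlanes_pos hl hk ((halfPlanes_nonneg L x).lt_of_ne' h)
  exact hx j ⟨radius x, θ, hr, by linarith [Real.pi_pos], he⟩

end Phases

end Cone

/-- On `sector l 0` the isometry onto `ℝ² ∖ {x₂ = 0, x₁ ≤ 0}` is `(r, θ) ↦ r (cos θ, sin θ)`, and on
`sector l (l / 2)` the isometry onto `ℝ² ∖ {x₂ = 0, x₁ ≥ 0}` is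
`(r, θ) ↦ r (cos (θ - l / 2 + π), sin (θ - l / 2 + π))`. -/
theorem mainTheorem9 :
    (∀ l : ℝ, 4 * Real.pi ≤ l → ∃ u : Cone l → ℝ,
      (∀ r θ : ℝ, 0 < r → |θ| < Real.pi →
        u (Cone.polar l (r, θ)) = max (r * Real.cos θ) 0) ∧
      (∀ r θ : ℝ, 0 < r → |θ - l / 2| < Real.pi →
        u (Cone.polar l (r, θ)) = max (-(r * Real.cos (θ - l / 2 + Real.pi))) 0) ∧
      (∀ x, x ∉ Cone.sector l 0 → x ∉ Cone.sector l (l / 2) → u x = 0) ∧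
      (∀ x, 0 ≤ u x) ∧
      ∀ R : ℝ, 0 < R →
        Cone.IsMinimizer (Cone.ball l R) 1 0 u ∧
        (∀ v, Cone.MemH1 (Cone.ball l R) v → Cone.MemH10 (Cone.ball l R) (v - u) →
          Cone.J (Cone.ball l R) 1 0 v ≤ Cone.J (Cone.ball l R) 1 0 u →
          v =ᵐ[(Cone.area l).restrict (Cone.ball l R)] u) ∧
        (Cone.positivePhases (Cone.ball l R) u).ncard = 2 ∧
        ∀ A ∈ Cone.positivePhases (Cone.ball l R) u, Cone.vertex l ∈ closure A) ∧
    (∀ (k : ℕ) (l : ℝ), 1 ≤ k → 4 * k * Real.pi ≤ l → ∃ u : Cone l → ℝ,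
      (∀ j : Fin k, ∀ r θ : ℝ, 0 < r → |θ - j * l / k| < Real.pi →
        u (Cone.polar l (r, θ)) = max (r * Real.cos (θ - j * l / k)) 0) ∧
      (∀ x, (∀ j : Fin k, x ∉ Cone.sector l (j * l / k)) → u x = 0) ∧
      (∀ x, 0 ≤ u x) ∧
      ∀ R : ℝ, 0 < R →
        Cone.IsMinimizer (Cone.ball l R) 1 0 u ∧
        (Cone.positivePhases (Cone.ball l R) u).ncard = k ∧
        ∀ A ∈ Cone.positivePhases (Cone.ball l R) u, Cone.vertex l ∈ closure A) := by
  have hpi := Real.pi_pos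
  constructor
  · intro l hl4
    have : Fact (0 < l) := ⟨by linarith⟩
    have hl : l = (2 : ℕ) * (l / 2) := by
      push_cast
      ring
    have hL : 2 * Real.pi ≤ l / 2 := by linarith
    refine ⟨Cone.halfPlanes (l / 2), fun r θ hr hθ => ?_, fun r θ hr hθ => ?_, fun x h0 h1 => ?_,
      Cone.halfPlanes_nonneg _, fun R hR => ⟨Cone.isMinimizer_halfPlanes hl hL hR,
        fun v hv hvu hJ => Cone.ae_eq_halfPlanes hl hL hR hv hvu hJ,
        Cone.ncard_positivePhases_halfPlanes hl hL (by norm_num) hR,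
        fun A hA => Cone.vertex_mem_closure_of_mem_positivePhases hl hL (by norm_num) hR hA⟩⟩
    · have := Cone.halfPlanes_polar_eq_max hl hL 0 hr (θ := θ) (by simpa using hθ)
      simpa using this
    · have := Cone.halfPlanes_polar_eq_max hl hL 1 hr (θ := θ) (by simpa using hθ)
      -- The half-turn in $\phi_-$ turns $x_1^-$ into the positive part of $r\cos(\theta-l/2)$, the
      -- half-plane function with $j=1$.
      rw [this, Real.cos_add_pi, Nat.cast_one, one_mul, mul_neg, neg_neg]
    · refine Cone.halfPlanes_eq_zero hl (by norm_num) fun j => ?_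
      fin_cases j
      · simpa using h0
      · simpa using h1
  · intro k l hk hlk
    have hk0 : (1 : ℝ) ≤ k := by exact_mod_cast hk
    have : Fact (0 < l) := ⟨lt_of_lt_of_le (by positivity) hlk⟩
    have hl : l = k * (l / k) := by
      field_simp
    have hL : 2 * Real.pi ≤ l / k := by
      rw [le_div_iff₀ (by linarith)]
      nlinarith
    refine ⟨Cone.halfPlanes (l / k), fun j r θ hr hθ => ?_, fun x h => ?_,
      Cone.halfPlanes_nonneg _, fun R hR => ⟨Cone.isMinimizer_halfPlanes hl hL hR,
        Cone.ncard_positivePhases_halfPlanes hl hL hk hR,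
        fun A hA => Cone.vertex_mem_closure_of_mem_positivePhases hl hL hk hR hA⟩⟩
    · rw [mul_div_assoc] at hθ ⊢
      exact Cone.halfPlanes_polar_eq_max hl hL j hr hθ
    · refine Cone.halfPlanes_eq_zero hl hk fun j => ?_
      rw [← mul_div_assoc]
      exact h j
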